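/- For $i=1,2,3$ let $K_i(z,w)=\sum_{n\ge 0}a^{(i)}_n(z\bar w)^n$ with $a^{(i)}_n>0$, the series converging for all $z,w$ in the open unit disc $\mathbb D$. Let $\mathcal H_{K_1}$ be the reproducing kernel Hilbert space with kernel $K_1$, and let $\phi\in\mathrm{Mult}(\mathcal H_{K_1})=\{\psi\in\mathrm{Hol}(\mathbb D):\psi f\in\mathcal H_{K_1}\text{ for all }f\in\mathcal H_{K_1}\}$. Write $\partial=\partial/\partial z$, $\bar\partial=\partial/\partial\bar w$, $\phi=\phi(\bar w)$, $\phi^*=\overline{\phi(\bar z)}$, and define $K:\mathbb D\times\mathbb D\to\mathcal M_3(\mathbb C)$ by $$K=\begin{pmatrix}K_1&-\bar\partial K_1&\tfrac12\bar\partial^2K_1-\bar\partial(\phi K_1)\\-\partial K_1&\partial\bar\partial K_1&-\tfrac12\partial\bar\partial^2K_1+\partial\bar\partial(\phi K_1)\\\tfrac12\partial^2K_1-\partial(\phi^*K_1)&-\tfrac12\partial^2\bar\partial K_1+\partial\bar\partial(\phi^*K_1)&\kappa\end{pmatrix}+\begin{pmatrix}0&0&0\\0&K_2&-\bar\partial K_2\\0&-\partial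 K_2&\partial\bar\partial K_2\end{pmatrix}+\begin{pmatrix}0&0&0\\0&0&0\\0&0&K_3\end{pmatrix},$$ $$\kappa=\tfrac14\partial^2\bar\partial^2K_1-\tfrac12\partial\bar\partial^2(\phi^*K_1)-\tfrac12\partial^2\bar\partial(\phi K_1)+\partial\bar\partial(\phi^*\phi K_1).$$ Let $\tilde K$ be defined in the same way from $\tilde K_i(z,w)=\sum_{n\ge0}\tilde a^{(i)}_n(z\bar w)^n$, with $\tilde a^{(i)}_n>0$ and convergence on $\mathbb D\times\mathbb D$, and from $\tilde\phi\in\mathrm{Mult}(\mathcal H_{\tilde K_1})$. Then $K$ and $\tilde K$ are non-negative definite kernels. Let $\mathcal H_K$ and $\mathcal H_{\tilde K}$ be the $\mathbb C^3$-valued reproducing kernel Hilbert spaces on $\mathbb D$ with kernels $K$ and $\tilde K$, suppose that multiplication by the coordinate function is a bounded operator $M_z$ on each of them, and let $T=M_z^*$ on $\mathcal H_K$ and $\tilde T=M_z^*$ on $\mathcal H_{\tilde K}$. Then $T$ and $\tilde T$ are quasi-similar if and only if they are similar. Here $T\in\mathcal B(\mathcal H)$ and $\tilde T\in\mathcal B(\tilde{\mathcal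 H})$ are quasi-similar if there are bounded injective operators with dense range $X:\mathcal H\to\tilde{\mathcal H}$ and $Y:\tilde{\mathcal H}\to\mathcal H$ such that $XT=\tilde TX$ and $TY=Y\tilde T$; they are similar if $XT=\tilde TX$ for some bounded invertible $X:\mathcal H\to\tilde{\mathcal H}$. -/

import Mathlib

open Complex ComplexConjugate
open scoped ComplexOrder InnerProductSpace

noncomputable section

namespace QS

/-! ### Wirtinger derivatives -/

/-- The Wirtinger derivative `∂f/∂z = (∂f/∂x - i ∂f/∂y) / 2`. -/
def wirtinger (f : ℂ → ℂ) (z : ℂ) : ℂ :=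
  (fderiv ℝ f z 1 - I * fderiv ℝ f z I) / 2

/-- The conjugate Wirtinger derivative `∂f/∂z̄ = (∂f/∂x + i ∂f/∂y) / 2`. -/
def wirtingerBar (f : ℂ → ℂ) (z : ℂ) : ℂ :=
  (fderiv ℝ f z 1 + I * fderiv ℝ f z I) / 2

/-- `∂F/∂z` for a function `F(z, w)`. -/
def dZ (F : ℂ → ℂ → ℂ) : ℂ → ℂ → ℂ :=
  fun z w => wirtinger (fun u => F u w) z

/-- `∂F/∂w̄` for a function `F(z, w)`. -/
def dWbar (F : ℂ → ℂ → ℂ) : ℂ → ℂ → ℂ :=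
  fun z w => wirtingerBar (fun u => F z u) w

/-! ### The kernels -/

/-- The scalar kernel `∑ aₙ (z w̄)ⁿ`. -/
def diagKernel (a : ℕ → ℝ) : ℂ → ℂ → ℂ :=
  fun z w => ∑' n : ℕ, (a n : ℂ) * (z * conj w) ^ n

/-- `aₙ > 0` for all `n`, and the series `∑ aₙ (z w̄)ⁿ` converges for all `z, w` in the disc. -/
def IsDiagCoeff (a : ℕ → ℝ) : Prop :=
  (∀ n, 0 < a n) ∧
    ∀ z w : UnitDisc, Summable fun n : ℕ => (a n : ℂ) * ((z : ℂ) * conj (w : ℂ)) ^ n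

/-- The function `φ(w̄) F(z, w)`. -/
def phiW (φ : ℂ → ℂ) (F : ℂ → ℂ → ℂ) : ℂ → ℂ → ℂ :=
  fun z w => φ (conj w) * F z w

/-- The function `conj (φ(z̄)) F(z, w)`. -/
def phiZ (φ : ℂ → ℂ) (F : ℂ → ℂ → ℂ) : ℂ → ℂ → ℂ :=
  fun z w => conj (φ (conj z)) * F z w

/-- The summand of the matrix kernel that is built from the first scalar kernel and `φ`. -/
def block1 (K₁ : ℂ → ℂ → ℂ) (φ : ℂ → ℂ) (z w : ℂ) : Matrix (Fin 3) (Fin 3) ℂ :=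
  !![K₁ z w,
      -dWbar K₁ z w,
      (1 / 2) * dWbar (dWbar K₁) z w - dWbar (phiW φ K₁) z w;
    -dZ K₁ z w,
      dZ (dWbar K₁) z w,
      -(1 / 2) * dZ (dWbar (dWbar K₁)) z w + dZ (dWbar (phiW φ K₁)) z w;
    (1 / 2) * dZ (dZ K₁) z w - dZ (phiZ φ K₁) z w,
      -(1 / 2) * dZ (dZ (dWbar K₁)) z w + dZ (dWbar (phiZ φ K₁)) z w,
      (1 / 4) * dZ (dZ (dWbar (dWbar K₁))) z w
        - (1 / 2) * dZ (dWbar (dWbar (phiZ φ K₁))) z w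
        - (1 / 2) * dZ (dZ (dWbar (phiW φ K₁))) z w
        + dZ (dWbar (phiZ φ (phiW φ K₁))) z w]

/-- The summand that is built from the second scalar kernel. -/
def block2 (K₂ : ℂ → ℂ → ℂ) (z w : ℂ) : Matrix (Fin 3) (Fin 3) ℂ :=
  !![0, 0, 0;
    0, K₂ z w, -dWbar K₂ z w;
    0, -dZ K₂ z w, dZ (dWbar K₂) z w]

/-- The summand that is built from the third scalar kernel. -/
def block3 (K₃ : ℂ → ℂ → ℂ) (z w : ℂ) : Matrix (Fin 3) (Fin 3) ℂ :=
  !![0, 0, 0;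
    0, 0, 0;
    0, 0, K₃ z w]

/-- The `3 × 3` matrix valued kernel on the disc attached to three coefficient sequences
(indexed by `0, 1, 2`) and `φ`, its values being regarded as operators on `ℂ³`. -/
def matKernel (a : Fin 3 → ℕ → ℝ) (φ : ℂ → ℂ) :
    Matrix UnitDisc UnitDisc (EuclideanSpace ℂ (Fin 3) →L[ℂ] EuclideanSpace ℂ (Fin 3)) :=
  Matrix.of fun z w => Matrix.toEuclideanCLM (n := Fin 3) (𝕜 := ℂ)
    (block1 (diagKernel (a 0)) φ z w + block2 (diagKernel (a 1)) z w
      + block3 (diagKernel (a 2)) z w)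

/-- A complex valued kernel on the disc, its values being regarded as operators on `ℂ`. -/
def scalarKernel (k : ℂ → ℂ → ℂ) : Matrix UnitDisc UnitDisc (ℂ →L[ℂ] ℂ) :=
  Matrix.of fun z w => k z w • ContinuousLinearMap.id ℂ ℂ

/-! ### Multipliers and multiplication by the coordinate -/

/-- The multiplier algebra of a reproducing kernel Hilbert space `H` of scalar functions on the
disc: the functions `ψ`, holomorphic on the disc, with `ψ f ∈ H` for all `f ∈ H`. -/
def Mult (H : Type*) [NormedAddCommGroup H] [InnerProductSpace ℂ H] [RKHS ℂ H UnitDisc ℂ] :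
    Set (ℂ → ℂ) :=
  {ψ | DifferentiableOn ℂ ψ (Metric.ball 0 1) ∧
    ∀ f : H, ∃ g : H, ∀ z : UnitDisc, g z = ψ z * f z}

/-- `M` is the operator `M_z` of multiplication by the coordinate function on `H`. -/
def IsMulZ {H V : Type*} [NormedAddCommGroup V] [InnerProductSpace ℂ V]
    [NormedAddCommGroup H] [InnerProductSpace ℂ H] [RKHS ℂ H UnitDisc V]
    (M : H →L[ℂ] H) : Prop :=
  ∀ (f : H) (z : UnitDisc), (M f) z = (z : ℂ) • f z

/-! ### Similarity and quasi-similarity -/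

section Similarity

variable {H H' : Type*} [NormedAddCommGroup H] [InnerProductSpace ℂ H]
  [NormedAddCommGroup H'] [InnerProductSpace ℂ H']

/-- A bounded operator is quasi-affine if it is injective and has dense range. -/
def QuasiAffine (X : H →L[ℂ] H') : Prop :=
  Function.Injective X ∧ DenseRange X

/-- Quasi-similarity: there are quasi-affine `X`, `Y` with `X T = T' X` and `T Y = Y T'`. -/
def QuasiSimilar (T : H →L[ℂ] H) (T' : H' →L[ℂ] H') : Prop :=
  ∃ (X : H →L[ℂ] H') (Y : H' →L[ℂ] H), QuasiAffine X ∧ QuasiAffine Y ∧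
    X ∘L T = T' ∘L X ∧ T ∘L Y = Y ∘L T'

/-- Similarity: there is a bounded invertible `X` with `X T = T' X`. -/
def Similar (T : H →L[ℂ] H) (T' : H' →L[ℂ] H') : Prop :=
  ∃ X : H ≃L[ℂ] H', (X : H →L[ℂ] H') ∘L T = T' ∘L (X : H →L[ℂ] H')

end Similarity

end QS

end

/-! Expanding the scalar kernels in monomials and differentiating termwise writes K(z,w) as a sum of
terms g(z)g(w)^*. Here g runs over the images of weighted monomials under the map that sends a
triple (f₀, f₁, f₂) to (f₀, f₁ - f₀', f₂ - f₁' + f₀''/2 - (ψf₀)'), with ψ = φ^*. This map is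
triangular, hence injective. So K is non-negative definite, and its space is a unitary copy of three
weighted spaces of power series with norms ∑|xₙ|²/aₙ. On triples, M_z acts by (zf₀, zf₁ + f₀, zf₂ +
f₁ + ψf₀).

The adjoints A, B of the quasi-affine operators intertwine the operators M_z in both directions. A
acts pointwise by a matrix (`Model.map_apply`), which is invertible at 0 because X is injective
(`Model.det_ne_zero`). The first series of the image of zⁿ in slot 0, and the third series of the
image of zⁿ in slot 2, solve a triangular recursion: up to a factor z², they are zⁿ times a
quadratic polynomial in n with power series coefficients. If that polynomial depends on n,
boundedness of A gives n²a'ₙ ≤ C a_{n+l}. Since B gives aₙ ≤ C'a'_{n+l'}, it follows that n²a'ₙ ≤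
C''a'_{n+j}. This is superexponential growth, impossible for a series converging on the disc
(`not_growth`, `QuadBound.eq_zero`). Hence A is triangular with diagonal entries nonzero at 0, and
its diagonal coefficients give a'ₙ ≤ C aₙ for each of the three weights. By symmetry the weights are
comparable (`Model.weights_le`).

For comparable weights the triples are the same, and only ψ and ψ' differ. The pointwise shear v ↦ v
+ (ψ - ψ')v₀e₁, which is f₁ ↦ f₁ + (ψ - ψ')f₀ on triples, then gives the similarity: multipliers
preserve the weight of slot 0, and boundedness of M_z makes this weight at most a constant times
that of slot 1 (`Model.exists_shear`). -/

noncomputable section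

namespace QS

open RKHS

/-! ### Uniqueness of the space with a given reproducing kernel -/

section General

variable {X V : Type*} [NormedAddCommGroup V] [InnerProductSpace ℂ V] [CompleteSpace V]

/-- The linear combinations of kernel functions. -/
def kerComb (H : Type*) [NormedAddCommGroup H] [InnerProductSpace ℂ H] [CompleteSpace H]
    [RKHS ℂ H X V] : (X × V →₀ ℂ) →ₗ[ℂ] H :=
  Finsupp.linearCombination ℂ fun p => kerFun H p.1 p.2

variable (H G : Type*) [NormedAddCommGroup H] [InnerProductSpace ℂ H] [CompleteSpace H]
  [RKHS ℂ H X V] [NormedAddCommGroup G] [InnerProductSpace ℂ G] [CompleteSpace G] [RKHS ℂ G X V]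

lemma denseRange_kerComb : DenseRange (kerComb (X := X) (V := V) H) := by
  have h := kerFun_dense (𝕜 := ℂ) (X := X) (V := V) H
  have hr : (LinearMap.range (kerComb (X := X) (V := V) H) : Set H)
      = Submodule.span ℂ {kerFun H x v | (x : X) (v : V)} := by
    rw [kerComb, Finsupp.range_linearCombination]
    congr 2
    ext f
    simp
  rw [DenseRange, ← LinearMap.coe_range, hr]
  exact (Submodule.dense_iff_topologicalClosure_eq_top).2 h

variable {H G}

/-- Inner products of kernel functions are matrix entries of the kernel, so the Gram matrices agree.
-/
lemma norm_kerComb_eq (h : kernel H = kernel G) (c : X × V →₀ ℂ) :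
    ‖kerComb H c‖ = ‖kerComb G c‖ := by
  have key : ⟪kerComb H c, kerComb H c⟫_ℂ = ⟪kerComb G c, kerComb G c⟫_ℂ := by
    simp only [kerComb, Finsupp.linearCombination_apply, Finsupp.sum_inner, Finsupp.inner_sum,
      inner_smul_left, inner_smul_right, ← kernel_inner, h]
  rw [@norm_eq_sqrt_re_inner ℂ, @norm_eq_sqrt_re_inner ℂ, key]

/-- The isometry between two spaces with the same kernel. -/
def kernelMap (H G : Type*) [NormedAddCommGroup H] [InnerProductSpace ℂ H] [CompleteSpace H]
    [RKHS ℂ H X V] [NormedAddCommGroup G] [InnerProductSpace ℂ G] [CompleteSpace G]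
    [RKHS ℂ G X V] : H →L[ℂ] G :=
  (kerComb (X := X) (V := V) G).extendOfNorm (kerComb (X := X) (V := V) H)

lemma kernelMap_kerComb (h : kernel H = kernel G) (c : X × V →₀ ℂ) :
    kernelMap H G (kerComb H c) = kerComb G c :=
  LinearMap.extendOfNorm_eq (denseRange_kerComb H)
    ⟨1, fun c => by rw [one_mul, norm_kerComb_eq h]⟩ c

lemma norm_kernelMap (h : kernel H = kernel G) (f : H) : ‖kernelMap H G f‖ = ‖f‖ := by
  refine (denseRange_kerComb (X := X) (V := V) H).induction_on f
    (isClosed_eq (by fun_prop) (by fun_prop)) fun c => ?_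
  rw [kernelMap_kerComb h, norm_kerComb_eq h]

lemma kernelMap_apply (h : kernel H = kernel G) (f : H) (x : X) : kernelMap H G f x = f x := by
  refine (denseRange_kerComb (X := X) (V := V) H).induction_on f
    (isClosed_eq ((continuous_eval x).comp (kernelMap H G).continuous) (continuous_eval x))
    fun c => ?_
  rw [kernelMap_kerComb h]
  refine ext_inner_left ℂ fun v => ?_
  simp only [← kerFun_inner]
  simp only [kerComb, Finsupp.linearCombination_apply, Finsupp.inner_sum,
      inner_smul_right, ← kernel_inner, h]

/-- Two reproducing kernel Hilbert spaces with the same kernel are equal as spaces of functions. -/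
theorem exists_isometry_of_kernel_eq (h : kernel H = kernel G) :
    ∃ U : H ≃ₗᵢ[ℂ] G, ∀ f x, U f x = f x := by
  refine ⟨⟨LinearEquiv.ofBijective (kernelMap H G).toLinearMap ⟨?_, fun g => ?_⟩,
    norm_kernelMap h⟩, fun f x => kernelMap_apply h f x⟩
  · exact (AddMonoidHomClass.isometry_of_norm (kernelMap H G) (norm_kernelMap h)).injective
  · refine ⟨kernelMap G H g, RKHS.ext fun x => ?_⟩
    exact (kernelMap_apply h _ x).trans (kernelMap_apply h.symm _ x)

end General

/-! ### Orthonormal bases from expansions of the kernel -/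

section Expansion

variable {X V ι : Type*} [NormedAddCommGroup V] [InnerProductSpace ℂ V]
  [FiniteDimensional ℂ V]

/-- The square summable sequence of the inner products `⟪g i x, v⟫`. -/
def expansionMap (g : ι → X → V) (hg : ∀ x v, Memℓp (fun i => ⟪g i x, v⟫_ℂ) 2) (x : X) :
    V →L[ℂ] lp (fun _ : ι => ℂ) 2 :=
  LinearMap.toContinuousLinearMap
    { toFun := fun v => ⟨fun i => ⟪g i x, v⟫_ℂ, hg x v⟩
      map_add' := fun _ _ => Subtype.ext <| funext fun _ => inner_add_right _ _ _
      map_smul' := fun _ _ => Subtype.ext <| funext fun _ => inner_smul_right _ _ _ }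

@[simp] lemma expansionMap_apply (g : ι → X → V) (hg : ∀ x v, Memℓp (fun i => ⟪g i x, v⟫_ℂ) 2)
    (x : X) (v : V) (i : ι) : expansionMap g hg x v i = ⟪g i x, v⟫_ℂ := rfl

omit [FiniteDimensional ℂ V] in
-- On the diagonal the expansion is a sum of squared moduli.
lemma memℓp_of_hasSum {g : ι → X → V} {K : Matrix X X (V →L[ℂ] V)}
    (hK : ∀ x y v w, HasSum (fun i => ⟪v, g i x⟫_ℂ * ⟪g i y, w⟫_ℂ) ⟪v, K x y w⟫_ℂ) (x : X) (v : V) :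
    Memℓp (fun i => ⟪g i x, v⟫_ℂ) 2 := by
  refine memℓp_gen ?_
  have h := (hK x x v v).summable.norm
  refine h.congr fun i => ?_
  rw [norm_mul, ← inner_conj_symm, RCLike.norm_conj]
  simp [sq]

/-- `ℓ²` as the reproducing kernel Hilbert space of the sums `∑ cᵢ gᵢ`. -/
@[reducible] def expansionRKHS (g : ι → X → V) (hg : ∀ x v, Memℓp (fun i => ⟪g i x, v⟫_ℂ) 2)
    (hinj : ∀ c : lp (fun _ : ι => ℂ) 2, (∀ x v, ∑' i, c i * ⟪v, g i x⟫_ℂ = 0) → c = 0) :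
    RKHS ℂ (lp (fun _ : ι => ℂ) 2) X V where
  coeCLM := ContinuousLinearMap.pi fun x => (expansionMap g hg x).adjoint
  coeCLM_injective := by
    refine (injective_iff_map_eq_zero _).2 fun c hc => hinj c fun x v => ?_
    have h : ⟪v, (expansionMap g hg x).adjoint c⟫_ℂ = 0 := by
      have := congrFun hc x
      simp only [ContinuousLinearMap.coe_pi', Pi.zero_apply] at this
      rw [this, inner_zero_right]
    rw [ContinuousLinearMap.adjoint_inner_right, lp.inner_eq_tsum] at h
    rw [← h]
    refine tsum_congr fun i => ?_
    simp [mul_comm]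

variable {g : ι → X → V} {K : Matrix X X (V →L[ℂ] V)}

/-- Evaluation at x is the adjoint of `expansionMap`, so the kernel function at x is `expansionMap`
itself, and the kernel is an ℓ² inner product. -/
lemma kernel_expansionRKHS
    (hK : ∀ x y v w, HasSum (fun i => ⟪v, g i x⟫_ℂ * ⟪g i y, w⟫_ℂ) ⟪v, K x y w⟫_ℂ)
    (hinj : ∀ c : lp (fun _ : ι => ℂ) 2, (∀ x v, ∑' i, c i * ⟪v, g i x⟫_ℂ = 0) → c = 0) :
    letI := expansionRKHS g (memℓp_of_hasSum hK) hinj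
    RKHS.kernel (lp (fun _ : ι => ℂ) 2) = K := by
  let _ := expansionRKHS g (memℓp_of_hasSum hK) hinj
  ext x y w
  refine ext_inner_left ℂ fun v => ?_
  have hker : ∀ x, kerFun (lp (fun _ : ι => ℂ) 2) x = expansionMap g (memℓp_of_hasSum hK) x := by
    intro x
    have : (ContinuousLinearMap.proj x ∘L RKHS.coeCLM (X := X) (V := V)
        (H := lp (fun _ : ι => ℂ) 2) ℂ) = (expansionMap g (memℓp_of_hasSum hK) x).adjoint := rfl
    rw [kerFun, this, ContinuousLinearMap.adjoint_adjoint]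
  rw [kernel_apply, hker, hker, ContinuousLinearMap.comp_apply,
    ContinuousLinearMap.adjoint_inner_right]
  refine HasSum.unique (lp.hasSum_inner _ _) ?_
  simpa [mul_comm] using hK x y v w

/-- Reproducing kernels are positive semidefinite, so it suffices to realise K as one. -/
theorem posSemidef_of_expansion
    (hK : ∀ x y v w, HasSum (fun i => ⟪v, g i x⟫_ℂ * ⟪g i y, w⟫_ℂ) ⟪v, K x y w⟫_ℂ)
    (hinj : ∀ c : lp (fun _ : ι => ℂ) 2, (∀ x v, ∑' i, c i * ⟪v, g i x⟫_ℂ = 0) → c = 0) :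
    K.PosSemidef := by
  let _ := expansionRKHS g (memℓp_of_hasSum hK) hinj
  rw [← kernel_expansionRKHS hK hinj]
  exact posSemidef_kernel _

/-- If `K x y = ∑ gᵢ(x) ⊗ gᵢ(y)^*` with `ℓ²`-independent `gᵢ`, then the space with kernel `K`
has the orthonormal basis `gᵢ`. -/
theorem exists_isometry_of_expansion
    (hK : ∀ x y v w, HasSum (fun i => ⟪v, g i x⟫_ℂ * ⟪g i y, w⟫_ℂ) ⟪v, K x y w⟫_ℂ)
    (hinj : ∀ c : lp (fun _ : ι => ℂ) 2, (∀ x v, ∑' i, c i * ⟪v, g i x⟫_ℂ = 0) → c = 0)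
    (H : Type*) [NormedAddCommGroup H] [InnerProductSpace ℂ H] [CompleteSpace H]
    [RKHS ℂ H X V] (hH : RKHS.kernel H = K) :
    ∃ U : H ≃ₗᵢ[ℂ] lp (fun _ : ι => ℂ) 2,
      ∀ f x v, HasSum (fun i => U f i * ⟪v, g i x⟫_ℂ) ⟪v, f x⟫_ℂ := by
  let _ := expansionRKHS g (memℓp_of_hasSum hK) hinj
  obtain ⟨U, hU⟩ := exists_isometry_of_kernel_eq (hH.trans (kernel_expansionRKHS hK hinj).symm)
  refine ⟨U, fun f x v => ?_⟩
  rw [← hU]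
  change HasSum _ ⟪v, (expansionMap g (memℓp_of_hasSum hK) x).adjoint (U f)⟫_ℂ
  rw [ContinuousLinearMap.adjoint_inner_right]
  have h := lp.hasSum_inner (𝕜 := ℂ) (G := fun _ : ι => ℂ)
    (expansionMap g (memℓp_of_hasSum hK) x v) (U f)
  simpa using h

end Expansion

/-! ### Automatic boundedness of pointwise operators -/

section ClosedGraph

variable {X V V' : Type*} [NormedAddCommGroup V] [InnerProductSpace ℂ V]
  [NormedAddCommGroup V'] [InnerProductSpace ℂ V']
  {H H' : Type*} [NormedAddCommGroup H] [InnerProductSpace ℂ H] [CompleteSpace H] [RKHS ℂ H X V]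
  [NormedAddCommGroup H'] [InnerProductSpace ℂ H'] [CompleteSpace H'] [RKHS ℂ H' X V']

/-- Pointwise application of operators that maps `H` into `H'` is bounded. -/
theorem exists_continuousLinearMap_of_mapsTo (S : X → V →L[ℂ] V')
    (h : ∀ f : H, ∃ g : H', ∀ x, g x = S x (f x)) :
    ∃ L : H →L[ℂ] H', ∀ f x, L f x = S x (f x) := by
  choose L hL using h
  let L' : H →ₗ[ℂ] H' :=
    { toFun := L
      map_add' := fun f g => RKHS.ext fun x => by simp [hL]
      map_smul' := fun c f => RKHS.ext fun x => by simp [hL] }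
  refine ⟨ContinuousLinearMap.ofIsClosedGraph (g := L') ?_, fun f x => hL f x⟩
  -- Evaluations are continuous, so the graph is an intersection of closed pointwise conditions.
  have : (L'.graph : Set (H × H')) = ⋂ x, {p : H × H' | p.2 x = S x (p.1 x)} := by
    ext p
    simp only [SetLike.mem_coe, LinearMap.mem_graph_iff, Set.mem_iInter, Set.mem_ofPred_eq]
    exact ⟨fun hp x => by rw [hp]; exact hL _ x, fun hp => RKHS.ext fun x => by
      rw [hp]; exact (hL _ x).symm⟩
  rw [this]
  exact isClosed_iInter fun x => isClosed_eq ((continuous_eval x).comp continuous_snd)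
    ((S x).continuous.comp ((continuous_eval x).comp continuous_fst))

end ClosedGraph

open Metric

/-! ### Series of holomorphic functions on the disc -/

/-- Cauchy's estimate on the circle of radius (1 - r)/2 about z, which stays inside |w| ≤ (1 + r)/2.
-/
lemma norm_deriv_le_of_bound {f : ℂ → ℂ} (hf : DifferentiableOn ℂ f (ball 0 1)) {r C : ℝ}
    (hr : r < 1) (hC : ∀ z, ‖z‖ ≤ (1 + r) / 2 → ‖f z‖ ≤ C) {z : ℂ} (hz : ‖z‖ ≤ r) :
    ‖deriv f z‖ ≤ C / ((1 - r) / 2) := by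
  have hsub : closedBall z ((1 - r) / 2) ⊆ closedBall 0 ((1 + r) / 2) := fun w hw => by
    rw [mem_closedBall_zero_iff]
    rw [mem_closedBall_iff_norm] at hw
    have := norm_add_le (w - z) z
    rw [sub_add_cancel] at this
    linarith
  refine Complex.norm_deriv_le_of_forall_mem_sphere_norm_le (by linarith) ?_ fun w hw =>
    hC w (mem_closedBall_zero_iff.1 (hsub (sphere_subset_closedBall hw)))
  refine (hf.mono fun w hw => ?_).diffContOnCl
  have := mem_closedBall_zero_iff.1 (hsub (closure_ball_subset_closedBall hw))
  rw [mem_ball_zero_iff]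
  linarith

/-- `∑ fₙ` consists of holomorphic functions and converges locally uniformly on the disc to `G`. -/
structure IsLocSum (G : ℂ → ℂ) (f : ℕ → ℂ → ℂ) : Prop where
  diff : ∀ n, DifferentiableOn ℂ (f n) (ball 0 1)
  bound : ∀ r < (1 : ℝ), ∃ u : ℕ → ℝ, Summable u ∧ ∀ n z, ‖z‖ ≤ r → ‖f n z‖ ≤ u n
  hasSum : ∀ z ∈ ball (0 : ℂ) 1, HasSum (fun n => f n z) (G z)

namespace IsLocSum

variable {G : ℂ → ℂ} {f : ℕ → ℂ → ℂ}

lemma exists_local (h : IsLocSum G f) {z : ℂ} (hz : z ∈ ball (0 : ℂ) 1) :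
    ∃ r < 1, z ∈ ball (0 : ℂ) r ∧ (∃ u : ℕ → ℝ, Summable u ∧ ∀ n w, w ∈ ball (0 : ℂ) r →
      ‖f n w‖ ≤ u n) ∧ Set.EqOn G (fun w => ∑' n, f n w) (ball 0 r) := by
  obtain ⟨r, hzr, hr⟩ := exists_between (mem_ball_zero_iff.1 hz)
  obtain ⟨u, hu, hb⟩ := h.bound r hr
  refine ⟨r, hr, mem_ball_zero_iff.2 hzr, ⟨u, hu, fun n w hw =>
    hb n w (mem_ball_zero_iff.1 hw).le⟩, fun w hw => ?_⟩
  exact (h.hasSum w (ball_subset_ball hr.le hw)).tsum_eq.symm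

lemma differentiableOn (h : IsLocSum G f) : DifferentiableOn ℂ G (ball 0 1) := by
  intro z hz
  obtain ⟨r, hr, hzr, ⟨u, hu, hb⟩, he⟩ := h.exists_local hz
  have h1 := differentiableOn_tsum_of_summable_norm hu
    (fun n => (h.diff n).mono (ball_subset_ball hr.le)) isOpen_ball hb
  exact ((h1.congr he).differentiableAt (isOpen_ball.mem_nhds hzr)).differentiableWithinAt

protected lemma deriv (h : IsLocSum G f) : IsLocSum (deriv G) fun n => deriv (f n) where
  diff n := (h.diff n).deriv isOpen_ball
  bound r hr := by
    obtain ⟨u, hu, hb⟩ := h.bound ((1 + r) / 2) (by linarith)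
    exact ⟨fun n => u n / ((1 - r) / 2), hu.div_const _, fun n z hz =>
      norm_deriv_le_of_bound (h.diff n) hr (hb n) hz⟩
  hasSum z hz := by
    obtain ⟨r, hr, hzr, ⟨u, hu, hb⟩, he⟩ := h.exists_local hz
    have h1 := hasSum_deriv_of_summable_norm hu
      (fun n => (h.diff n).mono (ball_subset_ball hr.le)) isOpen_ball hb hzr
    rwa [(he.eventuallyEq_of_mem (isOpen_ball.mem_nhds hzr)).deriv_eq]

lemma exists_bound_of_differentiableOn {ψ : ℂ → ℂ} (hψ : DifferentiableOn ℂ ψ (ball 0 1)) {r : ℝ}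
    (hr : r < 1) : ∃ C, ∀ z, ‖z‖ ≤ r → ‖ψ z‖ ≤ C := by
  obtain ⟨C, hC⟩ := (isCompact_closedBall (0 : ℂ) r).exists_bound_of_continuousOn
    (hψ.continuousOn.mono (closedBall_subset_ball hr))
  exact ⟨C, fun z hz => hC z (mem_closedBall_zero_iff.2 hz)⟩

lemma mul (h : IsLocSum G f) {ψ : ℂ → ℂ} (hψ : DifferentiableOn ℂ ψ (ball 0 1)) :
    IsLocSum (fun z => ψ z * G z) fun n z => ψ z * f n z where
  diff n := hψ.mul (h.diff n)
  bound r hr := by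
    obtain ⟨u, hu, hb⟩ := h.bound r hr
    obtain ⟨C, hC⟩ := exists_bound_of_differentiableOn hψ hr
    refine ⟨fun n => C * u n, hu.mul_left C, fun n z hz => ?_⟩
    rw [norm_mul]
    exact mul_le_mul (hC z hz) (hb n z hz) (by positivity) ((norm_nonneg _).trans (hC z hz))
  hasSum z hz := (h.hasSum z hz).mul_left _

end IsLocSum

/-! ### Sesquiholomorphic series and their Wirtinger derivatives -/

/-- `F(z, w) = ∑ fₙ(z) hₙ(w̄)`, locally uniformly on the bidisc. -/
structure IsSesqSum (F : ℂ → ℂ → ℂ) (f h : ℕ → ℂ → ℂ) : Prop where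
  diff : ∀ n, DifferentiableOn ℂ (f n) (ball 0 1)
  diff' : ∀ n, DifferentiableOn ℂ (h n) (ball 0 1)
  bound : ∀ r < (1 : ℝ), ∃ u : ℕ → ℝ, Summable u ∧
    ∀ n z v, ‖z‖ ≤ r → ‖v‖ ≤ r → ‖f n z‖ * ‖h n v‖ ≤ u n
  hasSum : ∀ z ∈ ball (0 : ℂ) 1, ∀ w ∈ ball (0 : ℂ) 1,
    HasSum (fun n => f n z * h n (conj w)) (F z w)

lemma conj_mem_ball {w : ℂ} (hw : w ∈ ball (0 : ℂ) 1) : conj w ∈ ball (0 : ℂ) 1 := by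
  simpa using hw

lemma wirtinger_eq_deriv {f : ℂ → ℂ} {z : ℂ} (hf : DifferentiableAt ℂ f z) :
    wirtinger f z = deriv f z := by
  have h : fderiv ℝ f z = (fderiv ℂ f z).restrictScalars ℝ := hf.fderiv_restrictScalars ℝ
  have hI : fderiv ℂ f z I = I * deriv f z := by
    simp
  rw [wirtinger, h]
  simp only [ContinuousLinearMap.coe_restrictScalars', hI, fderiv_apply_one_eq_deriv]
  linear_combination (-1 / 2) * deriv f z * I_mul_I

lemma wirtingerBar_comp_conj {f : ℂ → ℂ} {w : ℂ} (hf : DifferentiableAt ℂ f (conj w)) :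
    wirtingerBar (fun u => f (conj u)) w = deriv f (conj w) := by
  have h1 : HasFDerivAt f ((fderiv ℂ f (conj w)).restrictScalars ℝ) (conjCLE w) :=
    hf.hasFDerivAt.restrictScalars ℝ
  have h2 := (h1.comp w conjCLE.hasFDerivAt).fderiv
  change (fderiv ℝ (f ∘ conjCLE) w 1 + I * fderiv ℝ (f ∘ conjCLE) w I) / 2 = _
  rw [h2]
  simp
  linear_combination (-1 / 2) * deriv f (conj w) * I_mul_I

namespace IsSesqSum

variable {F : ℂ → ℂ → ℂ} {f h : ℕ → ℂ → ℂ}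

lemma left (hF : IsSesqSum F f h) {w : ℂ} (hw : w ∈ ball (0 : ℂ) 1) :
    IsLocSum (fun z => F z w) fun n z => f n z * h n (conj w) where
  diff n := (hF.diff n).mul_const _
  bound r hr := by
    obtain ⟨u, hu, hb⟩ := hF.bound (max r ‖w‖) (max_lt hr (mem_ball_zero_iff.1 hw))
    refine ⟨u, hu, fun n z hz => ?_⟩
    rw [norm_mul]
    exact hb n z _ (hz.trans (le_max_left _ _)) (by simp)
  hasSum z hz := hF.hasSum z hz w hw

lemma right (hF : IsSesqSum F f h) {z : ℂ} (hz : z ∈ ball (0 : ℂ) 1) :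
    IsLocSum (fun v => F z (conj v)) fun n v => f n z * h n v where
  diff n := (hF.diff' n).const_mul _
  bound r hr := by
    obtain ⟨u, hu, hb⟩ := hF.bound (max r ‖z‖) (max_lt hr (mem_ball_zero_iff.1 hz))
    refine ⟨u, hu, fun n v hv => ?_⟩
    rw [norm_mul]
    exact hb n _ v (by simp) (hv.trans (le_max_left _ _))
  hasSum v hv := by simpa using hF.hasSum z hz _ (conj_mem_ball hv)

protected lemma dZ (hF : IsSesqSum F f h) : IsSesqSum (dZ F) (fun n => deriv (f n)) h where
  diff n := (hF.diff n).deriv isOpen_ball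
  diff' := hF.diff'
  bound r hr := by
    obtain ⟨u, hu, hb⟩ := hF.bound ((1 + r) / 2) (by linarith)
    refine ⟨fun n => u n / ((1 - r) / 2), hu.div_const _, fun n z v hz hv => ?_⟩
    have h1 := norm_deriv_le_of_bound ((hF.diff n).mul_const (h n v)) hr
      (fun z hz => by rw [norm_mul]; exact hb n z v hz (by linarith)) hz
    have hd : DifferentiableAt ℂ (f n) z :=
      (hF.diff n).differentiableAt (isOpen_ball.mem_nhds (mem_ball_zero_iff.2 (by linarith)))
    rwa [deriv_mul_const hd, norm_mul] at h1
  hasSum z hz w hw := by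
    have h1 := hF.left hw
    have hd := h1.differentiableOn.differentiableAt (isOpen_ball.mem_nhds hz)
    rw [QS.dZ, wirtinger_eq_deriv hd]
    refine (h1.deriv.hasSum z hz).congr_fun fun n => ?_
    rw [deriv_mul_const ((hF.diff n).differentiableAt (isOpen_ball.mem_nhds hz))]

protected lemma dWbar (hF : IsSesqSum F f h) :
    IsSesqSum (dWbar F) f (fun n => deriv (h n)) where
  diff := hF.diff
  diff' n := (hF.diff' n).deriv isOpen_ball
  bound r hr := by
    obtain ⟨u, hu, hb⟩ := hF.bound ((1 + r) / 2) (by linarith)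
    refine ⟨fun n => u n / ((1 - r) / 2), hu.div_const _, fun n z v hz hv => ?_⟩
    have h1 := norm_deriv_le_of_bound ((hF.diff' n).const_mul (f n z)) hr
      (fun v hv => by rw [norm_mul]; exact hb n z v (by linarith) hv) hv
    have hd : DifferentiableAt ℂ (h n) v :=
      (hF.diff' n).differentiableAt (isOpen_ball.mem_nhds (mem_ball_zero_iff.2 (by linarith)))
    rwa [deriv_const_mul _ hd, norm_mul] at h1
  hasSum z hz w hw := by
    have h1 := hF.right hz
    have hd := h1.differentiableOn.differentiableAt (isOpen_ball.mem_nhds (conj_mem_ball hw))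
    have h2 := wirtingerBar_comp_conj hd
    simp only [conj_conj] at h2
    rw [QS.dWbar, h2]
    refine (h1.deriv.hasSum _ (conj_mem_ball hw)).congr_fun fun n => ?_
    rw [deriv_const_mul _
      ((hF.diff' n).differentiableAt (isOpen_ball.mem_nhds (conj_mem_ball hw)))]

lemma mul_left (hF : IsSesqSum F f h) {ψ : ℂ → ℂ} (hψ : DifferentiableOn ℂ ψ (ball 0 1)) :
    IsSesqSum (fun z w => ψ z * F z w) (fun n z => ψ z * f n z) h where
  diff n := hψ.mul (hF.diff n)
  diff' := hF.diff'
  bound r hr := by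
    obtain ⟨u, hu, hb⟩ := hF.bound r hr
    obtain ⟨C, hC⟩ := IsLocSum.exists_bound_of_differentiableOn hψ hr
    refine ⟨fun n => C * u n, hu.mul_left C, fun n z v hz hv => ?_⟩
    rw [norm_mul, mul_assoc]
    exact mul_le_mul (hC z hz) (hb n z v hz hv) (by positivity) ((norm_nonneg _).trans (hC z hz))
  hasSum z hz w hw := by simpa only [mul_assoc] using (hF.hasSum z hz w hw).mul_left (ψ z)

lemma mul_right (hF : IsSesqSum F f h) {φ : ℂ → ℂ} (hφ : DifferentiableOn ℂ φ (ball 0 1)) :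
    IsSesqSum (phiW φ F) f (fun n z => φ z * h n z) where
  diff := hF.diff
  diff' n := hφ.mul (hF.diff' n)
  bound r hr := by
    obtain ⟨u, hu, hb⟩ := hF.bound r hr
    obtain ⟨C, hC⟩ := IsLocSum.exists_bound_of_differentiableOn hφ hr
    refine ⟨fun n => C * u n, hu.mul_left C, fun n z v hz hv => ?_⟩
    rw [norm_mul, mul_left_comm]
    exact mul_le_mul (hC v hv) (hb n z v hz hv) (by positivity) ((norm_nonneg _).trans (hC v hv))
  hasSum z hz w hw := by
    refine ((hF.hasSum z hz w hw).mul_left (φ (conj w))).congr_fun fun n => ?_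
    ring

end IsSesqSum

/-- The function `conj (φ(z̄))`. -/
def starFun (φ : ℂ → ℂ) : ℂ → ℂ := fun z => conj (φ (conj z))

lemma differentiableOn_starFun {φ : ℂ → ℂ} (hφ : DifferentiableOn ℂ φ (ball 0 1)) :
    DifferentiableOn ℂ (starFun φ) (ball 0 1) := by
  intro z hz
  have h := (hφ.differentiableAt (isOpen_ball.mem_nhds (conj_mem_ball hz))).conj_conj
  rw [conj_conj] at h
  exact h.differentiableWithinAt

lemma deriv_starFun (φ : ℂ → ℂ) (z : ℂ) : deriv (starFun φ) z = conj (deriv φ (conj z)) :=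
  congrFun (deriv_conj_conj (f := φ)) z

lemma IsDiagCoeff.summable {a : ℕ → ℝ} (ha : IsDiagCoeff a) {r : ℝ} (h0 : 0 ≤ r) (hr : r < 1) :
    Summable fun n => a n * (r * r) ^ n := by
  have h := ha.2 (UnitDisc.mk r (by simpa [abs_of_nonneg h0] using hr))
    (UnitDisc.mk r (by simpa [abs_of_nonneg h0] using hr))
  simp only [UnitDisc.coe_mk, conj_ofReal] at h
  exact_mod_cast h

/-- The monomial `√aₙ zⁿ`. -/
def mono (a : ℕ → ℝ) (n : ℕ) : ℂ → ℂ := fun z => (√(a n) : ℂ) * z ^ n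

lemma starFun_mono (a : ℕ → ℝ) (n : ℕ) : starFun (mono a n) = mono a n := by
  funext z
  simp [starFun, mono]

lemma differentiable_mono (a : ℕ → ℝ) (n : ℕ) : Differentiable ℂ (mono a n) := by
  unfold mono
  fun_prop

lemma IsDiagCoeff.isSesqSum {a : ℕ → ℝ} (ha : IsDiagCoeff a) :
    IsSesqSum (diagKernel a) (mono a) (mono a) where
  diff n := (differentiable_mono a n).differentiableOn
  diff' n := (differentiable_mono a n).differentiableOn
  bound r hr := by
    -- The bound is also asked for negative r, while summability is available for radii in [0, 1).
    refine ⟨_, ha.summable (r := max r 0) (le_max_right _ _) (max_lt hr one_pos),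
      fun n z v hz hv => ?_⟩
    have h1 : ‖mono a n z‖ * ‖mono a n v‖ = a n * (‖z‖ * ‖v‖) ^ n := by
      simp only [mono, norm_mul, norm_pow, norm_real, Real.norm_eq_abs, abs_of_nonneg,
        Real.sqrt_nonneg]
      rw [mul_mul_mul_comm, Real.mul_self_sqrt (ha.1 n).le, mul_pow]
    rw [h1]
    have := (ha.1 n).le
    have h2 : ‖z‖ ≤ max r 0 := hz.trans (le_max_left _ _)
    have h3 : ‖v‖ ≤ max r 0 := hv.trans (le_max_left _ _)
    gcongr
  hasSum z hz w hw := by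
    have h := (ha.2 (UnitDisc.mk z (mem_ball_zero_iff.1 hz))
      (UnitDisc.mk w (mem_ball_zero_iff.1 hw))).hasSum
    simp only [UnitDisc.coe_mk] at h
    refine h.congr_fun fun n => ?_
    have : (√(a n) : ℂ) * √(a n) = a n := by
      rw [← ofReal_mul, Real.mul_self_sqrt (ha.1 n).le]
    simp only [mono, mul_pow, ← this]
    ring

/-! ### The model of the space with the matrix kernel -/

/-- The contribution `f e₀ - f' e₁ + (f''/2 - (ψ f)') e₂`, `f e₁ - f' e₂`, `f e₂` of a function
in the summand `s = 0, 1, 2`. -/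
def gen (ψ : ℂ → ℂ) (s : Fin 3) (f : ℂ → ℂ) (z : ℂ) : EuclideanSpace ℂ (Fin 3) :=
  ![!₂[f z, -deriv f z, 2⁻¹ * deriv (deriv f) z - deriv (fun u => ψ u * f u) z],
    !₂[0, f z, -deriv f z], !₂[0, 0, f z]] s

/-- The function on the disc that corresponds to a triple of functions. -/
def jet (ψ : ℂ → ℂ) (F : Fin 3 → ℂ → ℂ) (z : ℂ) : EuclideanSpace ℂ (Fin 3) :=
  ∑ s, gen ψ s (F s) z

lemma gen_const_mul (ψ : ℂ → ℂ) (s : Fin 3) (c : ℂ) (f : ℂ → ℂ) (z : ℂ) :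
    gen ψ s (fun u => c * f u) z = c • gen ψ s f z := by
  have h1 : deriv (fun u => c * f u) = fun u => c * deriv f u := by
    funext u
    exact deriv_const_mul_field c
  have h2 : deriv (fun u => ψ u * (c * f u)) z = c * deriv (fun u => ψ u * f u) z := by
    simp only [mul_left_comm (ψ _)]
    exact deriv_const_mul_field c
  have h3 : deriv (deriv (fun u => c * f u)) z = c * deriv (deriv f) z := by
    rw [h1]
    exact deriv_const_mul_field c
  ext j
  fin_cases s <;> fin_cases j <;> (simp [gen, h1, h2]; try ring)

lemma IsLocSum.hasSum_gen {G : ℂ → ℂ} {f : ℕ → ℂ → ℂ} (h : IsLocSum G f) {ψ : ℂ → ℂ}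
    (hψ : DifferentiableOn ℂ ψ (ball 0 1)) (s j : Fin 3) {z : ℂ} (hz : z ∈ ball (0 : ℂ) 1) :
    HasSum (fun n => gen ψ s (f n) z j) (gen ψ s G z j) := by
  have h0 := h.hasSum z hz
  have h1 := (h.deriv.hasSum z hz).neg
  have h2 := ((h.deriv.deriv.hasSum z hz).mul_left 2⁻¹).sub ((h.mul hψ).deriv.hasSum z hz)
  fin_cases s <;> fin_cases j <;>
    simp only [gen] <;> simp <;> assumption

lemma hasSum_fin_prod {n : ℕ} {f : Fin n × ℕ → ℂ} {b : Fin n → ℂ}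
    (h : ∀ s, HasSum (fun k => f (s, k)) (b s)) : HasSum f (∑ s, b s) := by
  have h1 : ∀ s, HasSum (fun p : Fin n × ℕ => if p.1 = s then f p else 0) (b s) := fun s => by
    have hi : Function.Injective fun k : ℕ => (s, k) := fun _ _ hkl => (Prod.ext_iff.1 hkl).2
    refine (hi.hasSum_iff fun p hp => if_neg fun hps => hp ⟨p.2, ?_⟩).1 ?_
    · rw [← hps]
    · simpa [Function.comp_def] using h s
  simpa using hasSum_sum fun s (_ : s ∈ Finset.univ) => h1 s

/-- The orthonormal basis of the model space, as functions on the disc. -/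
def basisFun (a : Fin 3 → ℕ → ℝ) (φ : ℂ → ℂ) (i : Fin 3 × ℕ) (z : UnitDisc) :
    EuclideanSpace ℂ (Fin 3) :=
  gen (starFun φ) i.1 (mono (a i.1) i.2) z

/-- The monomials have real coefficients, so conjugation only turns φ^* into φ and w into w̄. The
second factor of the expansion thus becomes holomorphic in w̄, as in the kernel. -/
lemma conj_gen_mono (a : ℕ → ℝ) (φ : ℂ → ℂ) (s k : Fin 3) (n : ℕ) (w : ℂ) :
    conj (gen (starFun φ) s (mono a n) w k) = gen φ s (mono a n) (conj w) k := by
  have h0 (u : ℂ) : conj (mono a n u) = mono a n (conj u) := by simp [mono]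
  have h1 (u : ℂ) : conj (deriv (mono a n) u) = deriv (mono a n) (conj u) := by
    conv_lhs => rw [← starFun_mono a n, deriv_starFun, conj_conj]
  have h2 : conj (deriv (deriv (mono a n)) w) = deriv (deriv (mono a n)) (conj w) := by
    have : deriv (mono a n) = starFun (deriv (mono a n)) := by
      funext u
      rw [starFun, ← h1, conj_conj]
    rw [this, deriv_starFun, conj_conj, ← this]
  have h3 : conj (deriv (fun u => starFun φ u * mono a n u) w)
      = deriv (fun u => φ u * mono a n u) (conj w) := by
    have : (fun u => starFun φ u * mono a n u) = starFun (fun u => φ u * mono a n u) := by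
      funext u
      simp only [starFun, map_mul, h0, conj_conj]
    rw [this, deriv_starFun, conj_conj]
  have h4 : conj (2 : ℂ) = 2 := map_ofNat _ 2
  fin_cases s <;> fin_cases k <;> simp [gen, h0, h1, h2, h3, h4]

/-! ### Expansion of the matrix kernel -/

section Kernel

variable {φ : ℂ → ℂ} (hφ : DifferentiableOn ℂ φ (ball 0 1))
include hφ

/-- Every entry comes from the monomial expansion by termwise differentiation, with φ^* attached to
the z-factor and φ to the w̄-factor. -/
lemma IsDiagCoeff.hasSum_block1 {a : ℕ → ℝ} (ha : IsDiagCoeff a) {z w : ℂ}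
    (hz : z ∈ ball (0 : ℂ) 1) (hw : w ∈ ball (0 : ℂ) 1) (j k : Fin 3) :
    HasSum (fun n => gen (starFun φ) 0 (mono a n) z j * gen φ 0 (mono a n) (conj w) k)
      (block1 (diagKernel a) φ z w j k) := by
  have h := ha.isSesqSum
  have hW := h.mul_right hφ
  have hZ : IsSesqSum (phiZ φ (diagKernel a)) (fun n u => starFun φ u * mono a n u) (mono a) :=
    h.mul_left (differentiableOn_starFun hφ)
  have hZW : IsSesqSum (phiZ φ (phiW φ (diagKernel a))) (fun n u => starFun φ u * mono a n u)
      (fun n u => φ u * mono a n u) :=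
    hW.mul_left (differentiableOn_starFun hφ)
  have e {F f g} (hF : IsSesqSum F f g) := hF.hasSum z hz w hw
  fin_cases j <;> fin_cases k <;> simp only [gen, block1] <;> simp
  · exact e h
  · exact (e h.dWbar).neg.congr_fun fun n => by ring
  · exact (((e h.dWbar.dWbar).mul_left 2⁻¹).sub (e hW.dWbar)).congr_fun fun n => by ring
  · exact (e h.dZ).neg.congr_fun fun n => by ring
  · exact e h.dWbar.dZ
  · exact (((e h.dWbar.dWbar.dZ).mul_left 2⁻¹).neg.add (e hW.dWbar.dZ)).congr_fun fun n => by ring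
  · exact (((e h.dZ.dZ).mul_left 2⁻¹).sub (e hZ.dZ)).congr_fun fun n => by ring
  · exact (((e h.dWbar.dZ.dZ).mul_left 2⁻¹).neg.add (e hZ.dWbar.dZ)).congr_fun fun n => by ring
  · exact (((((e h.dWbar.dWbar.dZ.dZ).mul_left 4⁻¹).sub
      ((e hZ.dWbar.dWbar.dZ).mul_left 2⁻¹)).sub ((e hW.dWbar.dZ.dZ).mul_left 2⁻¹)).add
        (e hZW.dWbar.dZ)).congr_fun fun n => by ring

omit hφ in
lemma IsDiagCoeff.hasSum_block2 {a : ℕ → ℝ} (ha : IsDiagCoeff a) {z w : ℂ}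
    (hz : z ∈ ball (0 : ℂ) 1) (hw : w ∈ ball (0 : ℂ) 1) (j k : Fin 3) :
    HasSum (fun n => gen (starFun φ) 1 (mono a n) z j * gen φ 1 (mono a n) (conj w) k)
      (block2 (diagKernel a) z w j k) := by
  have h := ha.isSesqSum
  have e {F f g} (hF : IsSesqSum F f g) := hF.hasSum z hz w hw
  fin_cases j <;> fin_cases k <;> simp only [gen, block2] <;> simp
  · exact e h
  · exact (e h.dWbar).neg.congr_fun fun n => by ring
  · exact (e h.dZ).neg.congr_fun fun n => by ring
  · exact e h.dWbar.dZ

omit hφ in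
lemma IsDiagCoeff.hasSum_block3 {a : ℕ → ℝ} (ha : IsDiagCoeff a) {z w : ℂ}
    (hz : z ∈ ball (0 : ℂ) 1) (hw : w ∈ ball (0 : ℂ) 1) (j k : Fin 3) :
    HasSum (fun n => gen (starFun φ) 2 (mono a n) z j * gen φ 2 (mono a n) (conj w) k)
      (block3 (diagKernel a) z w j k) := by
  have e := ha.isSesqSum.hasSum z hz w hw
  fin_cases j <;> fin_cases k <;> simp only [gen, block3] <;> simp
  exact e

lemma hasSum_matKernel {a : Fin 3 → ℕ → ℝ} (ha : ∀ i, IsDiagCoeff (a i)) (z w : UnitDisc)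
    (v v' : EuclideanSpace ℂ (Fin 3)) :
    HasSum (fun i => ⟪v, basisFun a φ i z⟫_ℂ * ⟪basisFun a φ i w, v'⟫_ℂ)
      ⟪v, matKernel a φ z w v'⟫_ℂ := by
  have hz := mem_ball_zero_iff.2 z.norm_lt_one
  have hw := mem_ball_zero_iff.2 w.norm_lt_one
  have key (j k : Fin 3) : HasSum (fun i => basisFun a φ i z j * conj (basisFun a φ i w k))
      ((block1 (diagKernel (a 0)) φ z w + block2 (diagKernel (a 1)) z w
        + block3 (diagKernel (a 2)) z w) j k) := by
    have h := hasSum_fin_prod (n := 3)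
      (f := fun i => basisFun a φ i z j * conj (basisFun a φ i w k))
      (b := ![block1 (diagKernel (a 0)) φ z w j k, block2 (diagKernel (a 1)) z w j k,
        block3 (diagKernel (a 2)) z w j k]) fun s => by
      simp only [basisFun, conj_gen_mono]
      fin_cases s
      · exact (ha 0).hasSum_block1 hφ hz hw j k
      · exact (ha 1).hasSum_block2 hz hw j k
      · exact (ha 2).hasSum_block3 hz hw j k
    simpa [Fin.sum_univ_three] using h
  have h := hasSum_sum fun j (_ : j ∈ Finset.univ) => hasSum_sum fun k (_ : k ∈ Finset.univ) =>
    (key j k).mul_left (conj (v j) * v' k)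
  have he : ⟪v, matKernel a φ z w v'⟫_ℂ = ∑ j, ∑ k, conj (v j) * v' k *
      (block1 (diagKernel (a 0)) φ z w + block2 (diagKernel (a 1)) z w
        + block3 (diagKernel (a 2)) z w) j k := by
    simp only [matKernel, Matrix.of_apply, PiLp.inner_apply, RCLike.inner_apply,
      Matrix.ofLp_toEuclideanCLM, Matrix.mulVec, dotProduct, Finset.sum_mul]
    exact Finset.sum_congr rfl fun j _ => Finset.sum_congr rfl fun k _ => by ring
  rw [he]
  refine h.congr_fun fun i => ?_
  simp only [PiLp.inner_apply, RCLike.inner_apply, Finset.sum_mul_sum]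
  exact Finset.sum_congr rfl fun j _ => Finset.sum_congr rfl fun k _ => by ring

end Kernel

open PowerSeries

/-! ### Power series on the disc -/

/-- The sum of a power series. -/
def pw (x : PowerSeries ℂ) (z : ℂ) : ℂ := ∑' n, coeff n x * z ^ n

/-- The power series converges absolutely on the disc. -/
def DiscSeries (x : PowerSeries ℂ) : Prop :=
  ∀ r : ℝ, 0 ≤ r → r < 1 → Summable fun n => ‖coeff n x‖ * r ^ n

namespace DiscSeries

variable {x y : PowerSeries ℂ}

lemma isLocSum (hx : DiscSeries x) : IsLocSum (pw x) fun n z => coeff n x * z ^ n where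
  diff n := by fun_prop
  bound r hr := by
    refine ⟨_, hx (max r 0) (le_max_right _ _) (max_lt hr one_pos), fun n z hz => ?_⟩
    rw [norm_mul, norm_pow]
    gcongr
    exact hz.trans (le_max_left _ _)
  hasSum z hz := by
    refine (Summable.of_norm ?_).hasSum
    simpa only [norm_mul, norm_pow] using hx ‖z‖ (norm_nonneg z) (mem_ball_zero_iff.1 hz)

lemma hasSum (hx : DiscSeries x) {z : ℂ} (hz : z ∈ ball (0 : ℂ) 1) :
    HasSum (fun n => coeff n x * z ^ n) (pw x z) := hx.isLocSum.hasSum z hz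

lemma differentiableOn (hx : DiscSeries x) : DifferentiableOn ℂ (pw x) (ball 0 1) :=
  hx.isLocSum.differentiableOn

lemma add (hx : DiscSeries x) (hy : DiscSeries y) : DiscSeries (x + y) := fun r h0 h1 => by
  refine Summable.of_nonneg_of_le (fun n => by positivity) (fun n => ?_)
    ((hx r h0 h1).add (hy r h0 h1))
  rw [map_add, ← add_mul]
  gcongr
  exact norm_add_le _ _

lemma smul (c : ℂ) (hx : DiscSeries x) : DiscSeries (c • x) := fun r h0 h1 => by
  refine ((hx r h0 h1).mul_left ‖c‖).congr fun n => ?_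
  simp [mul_assoc]

lemma sub (hx : DiscSeries x) (hy : DiscSeries y) : DiscSeries (x - y) := by
  have := hx.add (hy.smul (-1))
  rwa [neg_one_smul, ← sub_eq_add_neg] at this

lemma mul (hx : DiscSeries x) (hy : DiscSeries y) : DiscSeries (x * y) := fun r h0 h1 => by
  have h := summable_norm_sum_mul_antidiagonal_of_summable_norm
    (f := fun n => ‖coeff n x‖ * r ^ n) (g := fun n => ‖coeff n y‖ * r ^ n)
    (hx r h0 h1).norm (hy r h0 h1).norm
  refine Summable.of_nonneg_of_le (fun n => by positivity) (fun n => ?_) h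
  rw [coeff_mul, Real.norm_of_nonneg (Finset.sum_nonneg fun p _ => by positivity)]
  refine (mul_le_mul_of_nonneg_right (norm_sum_le _ _) (by positivity)).trans ?_
  rw [Finset.sum_mul]
  refine Finset.sum_le_sum fun p hp => ?_
  rw [norm_mul, ← Finset.HasAntidiagonal.mem_antidiagonal.1 hp, pow_add]
  exact le_of_eq (by ring)

lemma pw_add (hx : DiscSeries x) (hy : DiscSeries y) {z : ℂ} (hz : z ∈ ball (0 : ℂ) 1) :
    pw (x + y) z = pw x z + pw y z := by
  refine HasSum.tsum_eq (((hx.hasSum hz).add (hy.hasSum hz)).congr_fun fun n => ?_)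
  rw [map_add, add_mul]

lemma pw_mul (hx : DiscSeries x) (hy : DiscSeries y) {z : ℂ} (hz : z ∈ ball (0 : ℂ) 1) :
    pw (x * y) z = pw x z * pw y z := by
  have h1 := hx ‖z‖ (norm_nonneg z) (mem_ball_zero_iff.1 hz)
  have h2 := hy ‖z‖ (norm_nonneg z) (mem_ball_zero_iff.1 hz)
  rw [pw, pw, pw, tsum_mul_tsum_eq_tsum_sum_antidiagonal_of_summable_norm
    (by simpa only [norm_mul, norm_pow] using h1) (by simpa only [norm_mul, norm_pow] using h2)]
  refine tsum_congr fun n => ?_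
  rw [coeff_mul, Finset.sum_mul]
  refine Finset.sum_congr rfl fun p hp => ?_
  rw [← Finset.HasAntidiagonal.mem_antidiagonal.1 hp, pow_add]
  ring

lemma eq_of_pw_eq (hx : DiscSeries x) (hy : DiscSeries y)
    (h : ∀ z ∈ ball (0 : ℂ) 1, pw x z = pw y z) : x = y := by
  have hs := hx.sub hy
  have h0 : HasFPowerSeriesAt (0 : ℂ → ℂ)
      (FormalMultilinearSeries.ofScalars ℂ fun n => coeff n (x - y)) 0 := by
    rw [hasFPowerSeriesAt_iff]
    filter_upwards [isOpen_ball.mem_nhds (mem_ball_self one_pos)] with z hz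
    have h1 := (hx.hasSum hz).sub (hy.hasSum hz)
    rw [h z hz, sub_self] at h1
    refine h1.congr_fun fun n => ?_
    simp [FormalMultilinearSeries.coeff_ofScalars, mul_comm, mul_sub]
  have h2 := h0.eq_zero
  ext n
  rw [← sub_eq_zero, ← map_sub, ← FormalMultilinearSeries.coeff_ofScalars
    (p := fun n => coeff n (x - y)), h2, FormalMultilinearSeries.coeff_eq_zero,
    FormalMultilinearSeries.zero_apply]

end DiscSeries

lemma hasSum_pw_monomial (n : ℕ) (c z : ℂ) :
    HasSum (fun k => coeff k (monomial n c) * z ^ k) (c * z ^ n) := by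
  have h := hasSum_single (f := fun k => coeff k (monomial n c) * z ^ k) n fun k hk => by
    simp [coeff_monomial, hk]
  simpa using h

lemma discSeries_monomial (n : ℕ) (c : ℂ) : DiscSeries (monomial n c) := fun r _ _ =>
  summable_of_ne_finset_zero (s := {n}) fun k hk => by
    simp [coeff_monomial, Finset.notMem_singleton.1 hk]

lemma discSeries_zero : DiscSeries 0 := fun r _ _ => by simp

@[simp] lemma pw_zero (z : ℂ) : pw 0 z = 0 := by simp [pw]

lemma pw_zero_right (x : PowerSeries ℂ) : pw x 0 = coeff 0 x := by
  rw [pw, tsum_eq_single 0 fun n hn => by simp [hn]]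
  simp

lemma pw_monomial (n : ℕ) (c z : ℂ) : pw (monomial n c) z = c * z ^ n :=
  (hasSum_pw_monomial n c z).tsum_eq

lemma DiscSeries.pw_X_mul {x : PowerSeries ℂ} (hx : DiscSeries x) {z : ℂ}
    (hz : z ∈ ball (0 : ℂ) 1) : pw (X * x) z = z * pw x z := by
  rw [X_eq, (discSeries_monomial 1 1).pw_mul hx hz, pw_monomial, one_mul, pow_one]

lemma DiscSeries.X_mul {x : PowerSeries ℂ} (hx : DiscSeries x) : DiscSeries (X * x) := by
  rw [X_eq]
  exact (discSeries_monomial 1 1).mul hx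

/-- The power series with conjugate coefficients. -/
def conjSeries (x : PowerSeries ℂ) : PowerSeries ℂ := PowerSeries.mk fun n => conj (coeff n x)

lemma pw_conjSeries (x : PowerSeries ℂ) (z : ℂ) : pw (conjSeries x) z = conj (pw x (conj z)) := by
  rw [pw, pw, conj_tsum]
  simp [conjSeries]

/-! ### Weighted spaces of power series -/

/-- The power series in the weighted space `∑ |xₙ|² / aₙ < ∞`. -/
def Weighted (a : ℕ → ℝ) (x : PowerSeries ℂ) : Prop := Summable fun n => ‖coeff n x‖ ^ 2 / a n

namespace Weighted

variable {a b : ℕ → ℝ} {x y : PowerSeries ℂ}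

/-- By the inequality of the means, |xₙ|rⁿ ≤ |xₙ|²/aₙ + aₙr²ⁿ. -/
lemma discSeries (ha : IsDiagCoeff a) (hx : Weighted a x) : DiscSeries x := fun r h0 h1 => by
  refine Summable.of_nonneg_of_le (fun n => by positivity) (fun n => ?_)
    (Summable.add hx (ha.summable h0 h1))
  have han := ha.1 n
  have h2 : ‖coeff n x‖ * r ^ n = (‖coeff n x‖ / √(a n)) * (√(a n) * r ^ n) := by
    field_simp [(Real.sqrt_pos.2 han).ne']
  have h3 : ‖coeff n x‖ ^ 2 / a n = (‖coeff n x‖ / √(a n)) ^ 2 := by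
    rw [div_pow, Real.sq_sqrt han.le]
  have h4 : a n * (r * r) ^ n = (√(a n) * r ^ n) ^ 2 := by
    rw [mul_pow (√(a n)), Real.sq_sqrt han.le]
    ring
  rw [h2, h3, h4]
  nlinarith [sq_nonneg (‖coeff n x‖ / √(a n) - √(a n) * r ^ n),
    sq_nonneg (‖coeff n x‖ / √(a n)), sq_nonneg (√(a n) * r ^ n)]

lemma add (ha : ∀ n, 0 < a n) (hx : Weighted a x) (hy : Weighted a y) : Weighted a (x + y) := by
  refine Summable.of_nonneg_of_le (fun n => by have := ha n; positivity) (fun n => ?_)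
    ((Summable.add hx hy).mul_left 2)
  rw [← add_div, mul_div_assoc', map_add]
  have := (ha n).le
  gcongr
  have h := norm_add_le (coeff n x) (coeff n y)
  calc _ ≤ (‖coeff n x‖ + ‖coeff n y‖) ^ 2 := by gcongr
    _ ≤ _ := by nlinarith [sq_nonneg (‖coeff n x‖ - ‖coeff n y‖)]

lemma neg (hx : Weighted a x) : Weighted a (-x) := by simpa [Weighted] using hx

lemma conjSeries (hx : Weighted a x) : Weighted a (conjSeries x) := by
  simpa [Weighted, QS.conjSeries] using hx

lemma of_le (ha : ∀ n, 0 < a n) (hb : ∀ n, 0 < b n) {C : ℝ} (h : ∀ n, a n ≤ C * b n)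
    (hx : Weighted a x) : Weighted b x := by
  refine Summable.of_nonneg_of_le (fun n => by have := hb n; positivity) (fun n => ?_)
    (Summable.mul_left C hx)
  rw [mul_div_assoc', div_le_div_iff₀ (hb n) (ha n)]
  nlinarith [mul_le_mul_of_nonneg_left (h n) (sq_nonneg ‖coeff n x‖)]

end Weighted

lemma weighted_monomial (a : ℕ → ℝ) (n : ℕ) (c : ℂ) : Weighted a (monomial n c) :=
  summable_of_ne_finset_zero (s := {n}) fun k hk => by
    simp [coeff_monomial, Finset.notMem_singleton.1 hk]

/-! ### Algebra of the jet map on triples -/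

lemma jet_zero (ψ : ℂ → ℂ) (F : Fin 3 → ℂ → ℂ) (z : ℂ) : jet ψ F z 0 = F 0 z := by
  simp [jet, Fin.sum_univ_three, gen]

lemma jet_one (ψ : ℂ → ℂ) (F : Fin 3 → ℂ → ℂ) (z : ℂ) :
    jet ψ F z 1 = F 1 z - deriv (F 0) z := by
  simp [jet, Fin.sum_univ_three, gen]
  ring

lemma jet_two (ψ : ℂ → ℂ) (F : Fin 3 → ℂ → ℂ) (z : ℂ) :
    jet ψ F z 2 = F 2 z - deriv (F 1) z + 2⁻¹ * deriv (deriv (F 0)) z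
      - deriv (fun u => ψ u * F 0 u) z := by
  simp [jet, Fin.sum_univ_three, gen]
  ring

lemma deriv_congr_ball {f g : ℂ → ℂ} (h : Set.EqOn f g (ball 0 1)) :
    Set.EqOn (deriv f) (deriv g) (ball 0 1) := fun _ hz =>
  (h.eventuallyEq_of_mem (isOpen_ball.mem_nhds hz)).deriv_eq

lemma jet_congr {ψ ψ' : ℂ → ℂ} {F G : Fin 3 → ℂ → ℂ} (hψ : Set.EqOn ψ ψ' (ball 0 1))
    (h : ∀ s, Set.EqOn (F s) (G s) (ball 0 1)) {z : ℂ} (hz : z ∈ ball (0 : ℂ) 1) :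
    jet ψ F z = jet ψ' G z := by
  have h1 : Set.EqOn (fun u => ψ u * F 0 u) (fun u => ψ' u * G 0 u) (ball 0 1) :=
    fun u hu => by simp only [hψ hu, h 0 hu]
  ext j
  fin_cases j
  · simp [jet_zero, h 0 hz]
  · simp [jet_one, h 1 hz, deriv_congr_ball (h 0) hz]
  · simp [jet_two, h 2 hz, deriv_congr_ball (h 1) hz, deriv_congr_ball h1 hz,
      deriv_congr_ball (deriv_congr_ball (h 0)) hz]

/-- The jet is triangular: each component determines the next function once the earlier ones are
known. -/
lemma jet_pw_injective {ψ : ℂ → ℂ} {x y : Fin 3 → PowerSeries ℂ} (hx : ∀ s, DiscSeries (x s))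
    (hy : ∀ s, DiscSeries (y s))
    (h : ∀ z ∈ ball (0 : ℂ) 1, jet ψ (fun s => pw (x s)) z = jet ψ (fun s => pw (y s)) z) :
    x = y := by
  have hc (j : Fin 3) (z : ℂ) (hz : z ∈ ball (0 : ℂ) 1) :
      jet ψ (fun s => pw (x s)) z j = jet ψ (fun s => pw (y s)) z j := by rw [h z hz]
  have h0 : x 0 = y 0 := (hx 0).eq_of_pw_eq (hy 0) fun z hz => by
    simpa only [jet_zero] using hc 0 z hz
  have h1 : x 1 = y 1 := (hx 1).eq_of_pw_eq (hy 1) fun z hz => by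
    simpa [jet_one, h0] using hc 1 z hz
  have h2 : x 2 = y 2 := (hx 2).eq_of_pw_eq (hy 2) fun z hz => by
    simpa [jet_two, h0, h1] using hc 2 z hz
  funext s
  fin_cases s <;> assumption

lemma deriv_id_mul {f : ℂ → ℂ} (hf : DifferentiableOn ℂ f (ball 0 1)) :
    Set.EqOn (deriv fun u => u * f u) (fun u => f u + u * deriv f u) (ball 0 1) := fun z hz => by
  have := (hasDerivAt_id' z).fun_mul (hf.differentiableAt (isOpen_ball.mem_nhds hz)).hasDerivAt
  simpa using this.deriv

lemma deriv_add_ball {f g : ℂ → ℂ} (hf : DifferentiableOn ℂ f (ball 0 1))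
    (hg : DifferentiableOn ℂ g (ball 0 1)) :
    Set.EqOn (deriv fun u => f u + g u) (fun u => deriv f u + deriv g u) (ball 0 1) :=
  fun _ hz => deriv_fun_add (hf.differentiableAt (isOpen_ball.mem_nhds hz))
    (hg.differentiableAt (isOpen_ball.mem_nhds hz))

/-- Multiplication by the coordinate in terms of triples. -/
lemma jet_mul_id {ψ : ℂ → ℂ} (hψ : DifferentiableOn ℂ ψ (ball 0 1)) {F : Fin 3 → ℂ → ℂ}
    (hF : ∀ s, DifferentiableOn ℂ (F s) (ball 0 1)) {z : ℂ} (hz : z ∈ ball (0 : ℂ) 1) :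
    jet ψ ![fun u => u * F 0 u, fun u => u * F 1 u + F 0 u,
      fun u => u * F 2 u + F 1 u + ψ u * F 0 u] z = z • jet ψ F z := by
  have hd := (hF 0).deriv isOpen_ball
  have h2 : deriv (deriv fun u => u * F 0 u) z = 2 * deriv (F 0) z + z * deriv (deriv (F 0)) z := by
    rw [deriv_congr_ball (deriv_id_mul (hF 0)) hz,
      deriv_add_ball (hF 0) (differentiable_fun_id.differentiableOn.fun_mul hd) hz]
    simp only [deriv_id_mul hd hz]
    ring
  have h3 : deriv (fun u => ψ u * (u * F 0 u)) z
      = ψ z * F 0 z + z * deriv (fun u => ψ u * F 0 u) z := by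
    simp only [mul_left_comm (ψ _)]
    exact deriv_id_mul (hψ.mul (hF 0)) hz
  have h4 : deriv (fun u => u * F 1 u + F 0 u) z = F 1 z + z * deriv (F 1) z + deriv (F 0) z := by
    rw [deriv_add_ball (differentiable_fun_id.differentiableOn.fun_mul (hF 1)) (hF 0) hz]
    simp only [deriv_id_mul (hF 1) hz]
  ext j
  fin_cases j
  · simp [jet_zero]
  · simp [jet_one, deriv_id_mul (hF 0) hz]
    ring
  · simp [jet_two, h2, h3, h4]
    ring

/-- The change of the multiplier `ψ` in terms of triples. -/
lemma jet_change {ψ ψ' : ℂ → ℂ} (hψ : DifferentiableOn ℂ ψ (ball 0 1))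
    (hψ' : DifferentiableOn ℂ ψ' (ball 0 1)) {F : Fin 3 → ℂ → ℂ}
    (hF : ∀ s, DifferentiableOn ℂ (F s) (ball 0 1)) {z : ℂ} (hz : z ∈ ball (0 : ℂ) 1) :
    jet ψ' ![F 0, fun u => F 1 u + (ψ u - ψ' u) * F 0 u, F 2] z
      = jet ψ F z + ((ψ z - ψ' z) * jet ψ F z 0) • EuclideanSpace.single 1 1 := by
  have h1 : deriv (fun u => F 1 u + (ψ u - ψ' u) * F 0 u) z
      = deriv (F 1) z + deriv (fun u => (ψ u - ψ' u) * F 0 u) z :=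
    deriv_add_ball (hF 1) ((hψ.fun_sub hψ').fun_mul (hF 0)) hz
  have h2 : deriv (fun u => ψ u * F 0 u) z
      = deriv (fun u => (ψ u - ψ' u) * F 0 u) z + deriv (fun u => ψ' u * F 0 u) z := by
    refine Eq.trans ?_
      (deriv_add_ball ((hψ.fun_sub hψ').fun_mul (hF 0)) (hψ'.fun_mul (hF 0)) hz)
    congr 1
    funext u
    ring
  ext j
  fin_cases j
  · simp [jet_zero]
  · simp [jet_zero, jet_one]
    ring
  · simp [jet_zero, jet_two, h1, h2]
    ring

lemma weighted_of_lp {a : ℕ → ℝ} (ha : ∀ n, 0 < a n) {c : ℕ → ℂ} (hc : Summable fun n => ‖c n‖ ^ 2) :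
    Weighted a (PowerSeries.mk fun n => (√(a n) : ℂ) * c n) := by
  refine hc.congr fun n => ?_
  rw [coeff_mk, norm_mul, norm_real, Real.norm_of_nonneg (Real.sqrt_nonneg _), mul_pow,
    Real.sq_sqrt (ha n).le, mul_div_cancel_left₀ _ (ha n).ne']

lemma summable_sq_of_lp {ι : Type*} (c : lp (fun _ : ι => ℂ) 2) : Summable fun i => ‖c i‖ ^ 2 := by
  simpa using (lp.memℓp c).summable (by simp)

/-- The series of the coefficients `√aₙ cₙ`. -/
def lpSeries {ι : Type*} (a : ℕ → ℝ) (c : lp (fun _ : ι => ℂ) 2) (e : ℕ → ι) : PowerSeries ℂ :=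
  PowerSeries.mk fun n => (√(a n) : ℂ) * c (e n)

lemma weighted_lpSeries {ι : Type*} {a : ℕ → ℝ} (ha : ∀ n, 0 < a n) (c : lp (fun _ : ι => ℂ) 2)
    {e : ℕ → ι} (he : Function.Injective e) : Weighted a (lpSeries a c e) :=
  weighted_of_lp ha ((summable_sq_of_lp c).comp_injective he)

lemma eq_zero_of_lpSeries {ι : Type*} {a : ℕ → ℝ} (ha : ∀ n, 0 < a n)
    {c : lp (fun _ : ι => ℂ) 2} {e : ℕ → ι} (h : lpSeries a c e = 0) (n : ℕ) : c (e n) = 0 := by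
  have := congrArg (coeff n) h
  simpa [lpSeries, (Real.sqrt_pos.2 (ha n)).ne'] using this

lemma exists_lp_of_weighted {ι : Type*} {a : ι → ℝ} (ha : ∀ i, 0 < a i) {x : ι → ℂ}
    (hx : Summable fun i => ‖x i‖ ^ 2 / a i) :
    ∃ c : lp (fun _ : ι => ℂ) 2, ∀ i, (√(a i) : ℂ) * c i = x i := by
  refine ⟨⟨fun i => x i / √(a i), memℓp_gen ?_⟩, fun i => ?_⟩
  · simpa [div_pow, abs_of_nonneg (Real.sqrt_nonneg _), Real.sq_sqrt (ha _).le] using hx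
  · have : (√(a i) : ℂ) ≠ 0 := ofReal_ne_zero.2 (Real.sqrt_pos.2 (ha i)).ne'
    simp only
    field_simp

/-! ### The space of the matrix kernel as triples of series -/

section MatrixModel

variable {a : Fin 3 → ℕ → ℝ} (ha : ∀ i, IsDiagCoeff (a i)) {φ : ℂ → ℂ}
  (hφ : DifferentiableOn ℂ φ (ball 0 1))
include ha

lemma weighted_lpSeries_fin (c : lp (fun _ : Fin 3 × ℕ => ℂ) 2) (s : Fin 3) :
    Weighted (a s) (lpSeries (a s) c fun n => (s, n)) :=
  weighted_lpSeries (ha s).1 c fun _ _ h => (Prod.ext_iff.1 h).2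

include hφ

lemma hasSum_basisFun (c : lp (fun _ : Fin 3 × ℕ => ℂ) 2) (z : UnitDisc) (j : Fin 3) :
    HasSum (fun i => c i * basisFun a φ i z j)
      (jet (starFun φ) (fun s => pw (lpSeries (a s) c fun n => (s, n))) z j) := by
  simp only [jet, WithLp.ofLp_sum, Finset.sum_apply]
  refine hasSum_fin_prod fun s => ?_
  have h := ((weighted_lpSeries_fin ha c s).discSeries (ha s)).isLocSum.hasSum_gen
    (differentiableOn_starFun hφ) s j (mem_ball_zero_iff.2 z.norm_lt_one)
  refine h.congr_fun fun n => ?_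
  have he : (fun u => coeff n (lpSeries (a s) c fun n => (s, n)) * u ^ n)
      = fun u => c (s, n) * mono (a s) n u := by
    funext u
    simp only [lpSeries, coeff_mk, mono]
    ring
  rw [he, gen_const_mul]
  simp [basisFun]

/-- The combination is the jet of the triple with coefficients √aₙ·cₙ; the jet is injective and √aₙ
≠ 0. -/
lemma basisFun_independent (c : lp (fun _ : Fin 3 × ℕ => ℂ) 2)
    (hc : ∀ (z : UnitDisc) v, ∑' i, c i * ⟪v, basisFun a φ i z⟫_ℂ = 0) : c = 0 := by
  have h := jet_pw_injective (ψ := starFun φ) (x := fun s => lpSeries (a s) c fun n => (s, n))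
    (y := 0) (fun s => (weighted_lpSeries_fin ha c s).discSeries (ha s))
    (fun _ => discSeries_zero) fun z hz => by
      have h1 (j : Fin 3) : jet (starFun φ) (fun s => pw (lpSeries (a s) c fun n => (s, n))) z j
          = 0 := by
        have h2 := (hasSum_basisFun ha hφ c (UnitDisc.mk z (mem_ball_zero_iff.1 hz)) j).tsum_eq
        have h3 := hc (UnitDisc.mk z (mem_ball_zero_iff.1 hz)) (EuclideanSpace.single j 1)
        simp only [EuclideanSpace.inner_single_left, map_one, one_mul] at h3
        rw [← h3, h2, UnitDisc.coe_mk]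
      have h4 : pw 0 = fun _ => 0 := funext pw_zero
      ext j
      rw [h1]
      fin_cases j <;> simp [jet_zero, jet_one, jet_two, h4]
  ext ⟨s, n⟩
  exact eq_zero_of_lpSeries (ha s).1 (congrFun h s) n

theorem posSemidef_matKernel : (matKernel a φ).PosSemidef :=
  posSemidef_of_expansion (hasSum_matKernel hφ ha) (basisFun_independent ha hφ)

theorem exists_model (H : Type*) [NormedAddCommGroup H] [InnerProductSpace ℂ H] [CompleteSpace H]
    [RKHS ℂ H UnitDisc (EuclideanSpace ℂ (Fin 3))] (hH : RKHS.kernel H = matKernel a φ) :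
    ∃ U : H ≃ₗᵢ[ℂ] lp (fun _ : Fin 3 × ℕ => ℂ) 2, ∀ (f : H) (z : UnitDisc),
      f z = jet (starFun φ) (fun s => pw (lpSeries (a s) (U f) fun n => (s, n))) z := by
  obtain ⟨U, hU⟩ := exists_isometry_of_expansion (hasSum_matKernel hφ ha)
    (basisFun_independent ha hφ) H hH
  refine ⟨U, fun f z => ?_⟩
  ext j
  have h := hU f z (EuclideanSpace.single j 1)
  simp only [EuclideanSpace.inner_single_left, map_one, one_mul] at h
  exact h.unique (hasSum_basisFun ha hφ (U f) z j)

end MatrixModel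

/-! ### The scalar space and its multipliers -/

section ScalarModel

variable {a : ℕ → ℝ} (ha : IsDiagCoeff a)
include ha

lemma hasSum_scalarKernel (z w : UnitDisc) (v v' : ℂ) :
    HasSum (fun n => ⟪v, mono a n z⟫_ℂ * ⟪mono a n w, v'⟫_ℂ)
      ⟪v, scalarKernel (diagKernel a) z w v'⟫_ℂ := by
  have h := (ha.isSesqSum.hasSum z (mem_ball_zero_iff.2 z.norm_lt_one) w
    (mem_ball_zero_iff.2 w.norm_lt_one)).mul_left (conj v * v')
  have he : ⟪v, scalarKernel (diagKernel a) z w v'⟫_ℂ = conj v * v' * diagKernel a z w := by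
    simp [scalarKernel]
    ring
  rw [he]
  refine h.congr_fun fun n => ?_
  have : conj (mono a n w) = mono a n (conj (w : ℂ)) := by simp [mono]
  simp only [RCLike.inner_apply, this]
  ring

lemma hasSum_mono (c : lp (fun _ : ℕ => ℂ) 2) (z : UnitDisc) :
    HasSum (fun n => c n * mono a n z) (pw (lpSeries a c id) z) := by
  have h := ((weighted_lpSeries ha.1 c Function.injective_id).discSeries ha).hasSum
    (mem_ball_zero_iff.2 z.norm_lt_one)
  refine h.congr_fun fun n => ?_
  simp only [lpSeries, coeff_mk, mono, id]
  ring

theorem exists_scalar_model (H : Type*) [NormedAddCommGroup H] [InnerProductSpace ℂ H]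
    [CompleteSpace H] [RKHS ℂ H UnitDisc ℂ]
    (hH : RKHS.kernel H = scalarKernel (diagKernel a)) :
    ∃ U : H ≃ₗᵢ[ℂ] lp (fun _ : ℕ => ℂ) 2, ∀ (f : H) (z : UnitDisc),
      f z = pw (lpSeries a (U f) id) z := by
  obtain ⟨U, hU⟩ := exists_isometry_of_expansion (hasSum_scalarKernel ha) (fun c hc => by
    have h : lpSeries a c id = 0 :=
      ((weighted_lpSeries ha.1 c Function.injective_id).discSeries ha).eq_of_pw_eq
        discSeries_zero fun z hz => by
          have h1 := (hasSum_mono ha c (UnitDisc.mk z (mem_ball_zero_iff.1 hz))).tsum_eq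
          have h2 := hc (UnitDisc.mk z (mem_ball_zero_iff.1 hz)) 1
          simp only [RCLike.inner_apply, map_one, mul_one] at h2
          rw [pw_zero, ← h2, h1, UnitDisc.coe_mk]
    ext n
    exact eq_zero_of_lpSeries ha.1 h n) H hH
  refine ⟨U, fun f z => ?_⟩
  have h := hU f z 1
  simp only [RCLike.inner_apply, map_one, mul_one] at h
  exact h.unique (hasSum_mono ha (U f) z)

/-- A multiplier acts on the weighted space of power series. -/
theorem exists_series_of_mem_mult (H : Type*) [NormedAddCommGroup H] [InnerProductSpace ℂ H]
    [CompleteSpace H] [RKHS ℂ H UnitDisc ℂ]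
    (hH : RKHS.kernel H = scalarKernel (diagKernel a)) {φ : ℂ → ℂ} (hφ : φ ∈ Mult H) :
    ∃ m : PowerSeries ℂ, DiscSeries m ∧ Set.EqOn (starFun φ) (pw m) (ball 0 1) ∧
      ∀ x, Weighted a x → Weighted a (m * x) := by
  obtain ⟨U, hU⟩ := exists_scalar_model ha H hH
  have key (x : PowerSeries ℂ) (hx : Weighted a x) : ∃ y, Weighted a y ∧
      ∀ z ∈ ball (0 : ℂ) 1, starFun φ z * pw x z = pw y z := by
    -- Conjugating coefficients preserves the weighted space and turns multiplication by φ into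
    -- multiplication by φ^*.
    obtain ⟨c, hc⟩ := exists_lp_of_weighted ha.1 hx.conjSeries
    have hc' : lpSeries a c id = conjSeries x := by
      ext n
      simp [lpSeries, hc]
    obtain ⟨g, hg⟩ := hφ.2 (U.symm c)
    refine ⟨conjSeries (lpSeries a (U g) id),
      (weighted_lpSeries ha.1 _ Function.injective_id).conjSeries, fun z hz => ?_⟩
    have h := hg (UnitDisc.mk (conj z) (mem_ball_zero_iff.1 (conj_mem_ball hz)))
    rw [hU, hU, U.apply_symm_apply, hc', UnitDisc.coe_mk, pw_conjSeries, conj_conj] at h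
    rw [pw_conjSeries, h, starFun, map_mul, conj_conj]
  -- Applied to the constant 1, the multiplier yields its own power series.
  obtain ⟨m, hm, hm'⟩ := key (monomial 0 1) (weighted_monomial a 0 1)
  have hmd := hm.discSeries ha
  have hE : Set.EqOn (starFun φ) (pw m) (ball 0 1) := fun z hz => by
    rw [← hm' z hz, pw_monomial]
    simp
  refine ⟨m, hmd, hE, fun x hx => ?_⟩
  obtain ⟨y, hy, hy'⟩ := key x hx
  have : m * x = y := (hmd.mul (hx.discSeries ha)).eq_of_pw_eq (hy.discSeries ha) fun z hz => by
    rw [hmd.pw_mul (hx.discSeries ha) hz, ← hy' z hz, hE hz]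
  rwa [this]

end ScalarModel

/-! ### Growth of weights -/

lemma IsDiagCoeff.exists_le_four_pow {a : ℕ → ℝ} (ha : IsDiagCoeff a) :
    ∃ E, ∀ n, a n ≤ E * 4 ^ n := by
  have h := ha.summable (r := 1 / 2) (by norm_num) (by norm_num)
  refine ⟨∑' n, a n * (1 / 2 * (1 / 2)) ^ n, fun n => ?_⟩
  have h1 := h.le_tsum n fun k _ => mul_nonneg (ha.1 k).le (by positivity)
  have h2 : a n * (1 / 2 * (1 / 2) : ℝ) ^ n * 4 ^ n = a n := by
    rw [mul_assoc, ← mul_pow]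
    norm_num
  calc a n = _ := h2.symm
    _ ≤ _ := by gcongr

/-- A gain of n² over boundedly many indices iterates to growth faster than every exponential,
against b ≤ E·4ⁿ. -/
lemma not_growth {b : ℕ → ℝ} (hb : ∀ n, 0 < b n) {D E C : ℝ} (hD : ∀ n, b n ≤ D * b (n + 1))
    (hE : ∀ n, b n ≤ E * 4 ^ n) {j N : ℕ} (h : ∀ n ≥ N, (n : ℝ) ^ 2 * b n ≤ C * b (n + j)) :
    False := by
  have hC : 0 < C := by
    have h1 := h (N + 1) (by lia)
    have h2 : 0 < ((N + 1 : ℕ) : ℝ) ^ 2 * b (N + 1) := mul_pos (by positivity) (hb _)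
    exact pos_of_mul_pos_left (h2.trans_le h1) (hb _).le
  have hD0 : 0 < D := pos_of_mul_pos_left ((hb 0).trans_le (hD 0)) (hb _).le
  obtain ⟨K, hK⟩ := exists_nat_ge (2 * 4 ^ (j + 1) * (C * D))
  set N₁ := max N (K + 1) with hN₁
  -- One extra index, paid for by D, makes the step length j + 1 positive. The factor 2·4^(j+1)
  -- exceeds the growth of 4ⁿ over this step by 2, so iteration defeats the constant E.
  have step (n : ℕ) (hn : N₁ ≤ n) : 2 * 4 ^ (j + 1) * b n ≤ b (n + (j + 1)) := by
    have h1 : (n : ℝ) ^ 2 * b n ≤ C * D * b (n + (j + 1)) := by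
      refine (h n ((le_max_left _ _).trans hn)).trans ?_
      rw [mul_assoc]
      exact mul_le_mul_of_nonneg_left (hD (n + j)) hC.le
    have h2 : (K : ℝ) + 1 ≤ n := by exact_mod_cast (le_max_right _ _).trans hn
    have h3 : 2 * 4 ^ (j + 1) * (C * D) ≤ (n : ℝ) ^ 2 := by nlinarith
    have h4 := mul_le_mul_of_nonneg_right h3 (hb n).le
    refine le_of_mul_le_mul_left ?_ (mul_pos hC hD0)
    linarith
  have iter (i : ℕ) : (2 * 4 ^ (j + 1)) ^ i * b N₁ ≤ b (N₁ + i * (j + 1)) := by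
    induction i with
    | zero => simp
    | succ i ih =>
      have h1 := step (N₁ + i * (j + 1)) (by lia)
      rw [show N₁ + (i + 1) * (j + 1) = N₁ + i * (j + 1) + (j + 1) by ring]
      refine le_trans ?_ h1
      rw [pow_succ, mul_right_comm, mul_comm]
      gcongr
  obtain ⟨i, hi⟩ := pow_unbounded_of_one_lt (E * 4 ^ N₁ / b N₁) one_lt_two
  rw [div_lt_iff₀ (hb _)] at hi
  have h1 := (iter i).trans (hE _)
  rw [mul_pow, pow_add 4 N₁, ← pow_mul, mul_comm (j + 1) i] at h1
  have h2 : (0 : ℝ) < 4 ^ (i * (j + 1)) := by positivity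
  nlinarith

/-- A nonconstant polynomial in n of degree at most two grows at least linearly. -/
lemma exists_le_norm_quadratic (α β γ : ℂ) (h : ¬(β = 0 ∧ γ = 0)) :
    ∃ c > 0, ∃ N : ℕ, ∀ n ≥ N, c * (n : ℝ) ≤ ‖α + n * β + n.choose 2 * γ‖ := by
  by_cases hγ : γ = 0
  · have hβ : 0 < ‖β‖ := norm_pos_iff.2 fun hβ => h ⟨hβ, hγ⟩
    obtain ⟨N, hN⟩ := exists_nat_ge (2 * ‖α‖ / ‖β‖)
    refine ⟨‖β‖ / 2, by positivity, N, fun n hn => ?_⟩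
    have h1 : 2 * ‖α‖ ≤ n * ‖β‖ := by
      rw [← div_le_iff₀ hβ]
      exact hN.trans (by exact_mod_cast hn)
    have h2 := norm_sub_le (α + n * β) α
    rw [add_sub_cancel_left, norm_mul, norm_natCast] at h2
    rw [hγ, mul_zero, add_zero]
    linarith
  · have hγ' : 0 < ‖γ‖ := norm_pos_iff.2 hγ
    obtain ⟨N, hN⟩ := exists_nat_ge (2 * (1 + ‖α‖ + ‖β‖) / ‖γ‖)
    refine ⟨1, one_pos, N + 1, fun n hn => ?_⟩
    have h1 : 2 * (1 + ‖α‖ + ‖β‖) ≤ (n - 1) * ‖γ‖ := by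
      rw [← div_le_iff₀ hγ']
      refine hN.trans ?_
      have : (N : ℝ) + 1 ≤ n := by exact_mod_cast hn
      linarith
    have hn1 : (1 : ℝ) ≤ n := by exact_mod_cast (le_add_self.trans hn : 1 ≤ n)
    have h2 := norm_sub_le (α + n * β + n.choose 2 * γ) (α + n * β)
    rw [add_sub_cancel_left, norm_mul, norm_natCast, Nat.cast_choose_two] at h2
    have h3 := norm_add_le α (n * β)
    rw [norm_mul, norm_natCast] at h3
    have h4 := mul_le_mul_of_nonneg_left h1 (zero_le_one.trans hn1)
    have h5 := mul_le_mul_of_nonneg_right hn1 (norm_nonneg α)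
    nlinarith

/-! ### Quadratic bounds between weights -/

/-- The weights `b`, `a` are related by the quadratic polynomial with coefficients `p`, `q`, `r`. -/
def QuadBound (p q r : PowerSeries ℂ) (b a : ℕ → ℝ) : Prop :=
  ∃ C : ℝ, ∀ n k l : ℕ, k + 2 = n + l →
    ‖coeff l p + n * coeff l q + n.choose 2 * coeff l r‖ ^ 2 * b n ≤ C * a k

/-- Some coefficient index l carries a genuine dependence on n; its linear growth is squared by the
bound. -/
lemma QuadBound.exists_sq_le {p q r : PowerSeries ℂ} {b a : ℕ → ℝ} (h : QuadBound p q r b a)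
    (ha : ∀ n, 0 < a n) (hb : ∀ n, 0 < b n) {D : ℝ} (hD : ∀ n, a n ≤ D * a (n + 1))
    (hqr : ¬(q = 0 ∧ r = 0)) :
    ∃ (l N : ℕ) (C : ℝ), ∀ n ≥ N, (n : ℝ) ^ 2 * b n ≤ C * a (n + l) := by
  obtain ⟨C, hC⟩ := h
  obtain ⟨l, hl⟩ : ∃ l, ¬(coeff l q = 0 ∧ coeff l r = 0) := by
    by_contra! hl
    exact hqr ⟨PowerSeries.ext fun l => by simpa using (hl l).1,
      PowerSeries.ext fun l => by simpa using (hl l).2⟩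
  obtain ⟨c, hc, N, hN⟩ := exists_le_norm_quadratic (coeff l p) _ _ hl
  have hC0 : 0 ≤ C := by
    -- Any admissible instance shows that the constant is non-negative.
    have h1 := hC 2 l l (by lia)
    have h2 := mul_nonneg (sq_nonneg ‖coeff l p + (2 : ℕ) * coeff l q
      + (Nat.choose 2 2 : ℕ) * coeff l r‖) (hb 2).le
    exact nonneg_of_mul_nonneg_left (h2.trans h1) (ha l)
  have hD0 : 0 < D := pos_of_mul_pos_left ((ha 0).trans_le (hD 0)) (ha _).le
  refine ⟨l, max N 2, C * (D * D) / c ^ 2, fun n hn => ?_⟩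
  have h2 : 2 ≤ n := (le_max_right _ _).trans hn
  have h3 := hC n (n - 2 + l) l (by lia)
  -- The factor X² in the recursion shifts the index by two; D² undoes the shift.
  have h4 : a (n - 2 + l) ≤ D * D * a (n + l) := by
    have h5 := hD (n - 2 + l)
    have h6 := hD (n - 2 + l + 1)
    rw [show n - 2 + l + 1 + 1 = n + l by lia] at h6
    calc _ ≤ _ := h5
      _ ≤ D * (D * a (n + l)) := by gcongr
      _ = _ := by ring
  have h5 : (c * n) ^ 2 ≤ ‖coeff l p + n * coeff l q + n.choose 2 * coeff l r‖ ^ 2 := by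
    have := hN n ((le_max_left _ _).trans hn)
    gcongr
  have h6 := mul_le_mul_of_nonneg_right h5 (hb n).le
  have h7 := mul_le_mul_of_nonneg_left h4 hC0
  rw [div_mul_eq_mul_div, le_div_iff₀ (by positivity)]
  linarith

/-- Without dependence on n, the index l = 2 makes k = n and compares the weights at the same place.
-/
lemma QuadBound.exists_le {p q r : PowerSeries ℂ} {b a : ℕ → ℝ} (h : QuadBound p q r b a)
    (hqr : q = 0 ∧ r = 0) (hp : coeff 2 p ≠ 0) : ∃ C : ℝ, ∀ n, b n ≤ C * a n := by
  obtain ⟨C, hC⟩ := h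
  have hp' : 0 < ‖coeff 2 p‖ ^ 2 := by positivity
  refine ⟨C / ‖coeff 2 p‖ ^ 2, fun n => ?_⟩
  have h1 := hC n n 2 rfl
  simp only [hqr, map_zero, mul_zero, add_zero] at h1
  rw [div_mul_eq_mul_div, le_div_iff₀ hp']
  linarith

/-- A nonconstant polynomial gains n² in one direction. The reverse bound loses only a shift of the
index, so the composite contradicts `not_growth`. -/
theorem QuadBound.eq_zero {p q r p' q' r' : PowerSeries ℂ} {b a : ℕ → ℝ}
    (h : QuadBound p q r b a) (h' : QuadBound p' q' r' a b)
    (ha : IsDiagCoeff a) (hb : IsDiagCoeff b)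
    (hDa : ∃ D, ∀ n, a n ≤ D * a (n + 1)) (hDb : ∃ D, ∀ n, b n ≤ D * b (n + 1))
    (hp' : q' = 0 ∧ r' = 0 → coeff 2 p' ≠ 0) : q = 0 ∧ r = 0 := by
  by_contra hqr
  obtain ⟨D, hD⟩ := hDa
  obtain ⟨D', hD'⟩ := hDb
  obtain ⟨E, hE⟩ := hb.exists_le_four_pow
  obtain ⟨l, N, C, hC⟩ := h.exists_sq_le ha.1 hb.1 hD hqr
  obtain ⟨l', N', C', hC'⟩ : ∃ (l N : ℕ) (C : ℝ), ∀ n ≥ N, a n ≤ C * b (n + l) := by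
    -- Only this weak comparison is needed: it holds without shift if the reverse polynomial is
    -- constant, and otherwise after dropping the factor n².
    by_cases hqr' : q' = 0 ∧ r' = 0
    · obtain ⟨C', hC'⟩ := h'.exists_le hqr' (hp' hqr')
      exact ⟨0, 0, C', fun n _ => hC' n⟩
    · obtain ⟨l', N', C', hC'⟩ := h'.exists_sq_le hb.1 ha.1 hD' hqr'
      refine ⟨l', max N' 1, C', fun n hn => le_trans ?_ (hC' n ((le_max_left _ _).trans hn))⟩
      have h1 : (1 : ℝ) ≤ n := by exact_mod_cast (le_max_right _ _).trans hn
      nlinarith [ha.1 n, mul_le_mul_of_nonneg_right (one_le_pow₀ (n := 2) h1) (ha.1 n).le]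
  have hC0 : 0 ≤ C := by
    have h1 := hC N le_rfl
    exact nonneg_of_mul_nonneg_left
      ((mul_nonneg (sq_nonneg (N : ℝ)) (hb.1 N).le).trans h1) (ha.1 _)
  refine not_growth hb.1 hD' hE (C := C * C') (j := l + l') (N := max N N') fun n hn => ?_
  have h1 := hC n ((le_max_left _ _).trans hn)
  have h2 := hC' (n + l) (((le_max_right _ _).trans hn).trans (by lia))
  rw [add_assoc] at h2
  calc _ ≤ _ := h1
    _ ≤ C * (C' * b (n + (l + l'))) := by gcongr
    _ = _ := by ring

/-- The solution of a triangular recursion of power series. -/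
lemma X_sq_mul_eq {x y z : ℕ → PowerSeries ℂ} (hz : ∀ n, z (n + 1) = X * z n)
    (hy : ∀ n, y (n + 1) = X * y n - z n) (hx : ∀ n, x (n + 1) = X * x n - y n) (n : ℕ) :
    X ^ 2 * x n = X ^ n * (X ^ 2 * x 0 - (n : PowerSeries ℂ) * (X * y 0)
      + (n.choose 2 : PowerSeries ℂ) * z 0) := by
  -- The factors X and X² clear the powers X^(n-1) and X^(n-2) of the closed formulas, which do not
  -- exist for small n.
  have hz' (n : ℕ) : z n = X ^ n * z 0 := by
    induction n with
    | zero => simp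
    | succ n ih => rw [hz, ih, pow_succ]; ring
  have hy' (n : ℕ) : X * y n = X ^ n * (X * y 0 - (n : PowerSeries ℂ) * z 0) := by
    induction n with
    | zero => simp
    | succ n ih =>
      rw [hy, mul_sub, ih, hz' n]
      push_cast
      ring
  induction n with
  | zero => simp
  | succ n ih =>
    have h1 : X ^ 2 * x (n + 1) = X * (X ^ 2 * x n) - X * (X * y n) := by rw [hx]; ring
    rw [h1, hy' n, ih, Nat.choose_succ_succ' n 1, Nat.choose_one_right]
    push_cast
    ring

lemma coeff_natCast_mul' (l n : ℕ) (q : PowerSeries ℂ) :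
    coeff l ((n : PowerSeries ℂ) * q) = n * coeff l q := by
  rw [← map_natCast (C (R := ℂ)) n, coeff_C_mul]

/-- Bounds for the coefficients of a solution of the recursion give a `QuadBound`. -/
lemma quadBound_of_recursion {x y z : ℕ → PowerSeries ℂ} (hz : ∀ n, z (n + 1) = X * z n)
    (hy : ∀ n, y (n + 1) = X * y n - z n) (hx : ∀ n, x (n + 1) = X * x n - y n)
    {b a : ℕ → ℝ} {C : ℝ} (h : ∀ n k, ‖coeff k (x n)‖ ^ 2 * b n ≤ C * a k) :
    QuadBound (X ^ 2 * x 0) (-(X * y 0)) (z 0) b a := by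
  refine ⟨C, fun n k l hk => ?_⟩
  have h1 := congrArg (coeff (k + 2)) (X_sq_mul_eq hz hy hx n)
  rw [add_comm k 2, coeff_X_pow_mul', if_pos (by lia), Nat.add_sub_cancel_left, add_comm 2 k,
    hk, add_comm n l, coeff_X_pow_mul] at h1
  have h2 := h n k
  rw [h1, map_add, map_sub, coeff_natCast_mul', coeff_natCast_mul', sub_eq_add_neg, ← mul_neg,
    ← map_neg] at h2
  exact h2

/-! ### Coordinates on a space of triples -/

/-- A space of functions on the disc described by triples of power series with weights `a`. -/
structure Model (a : Fin 3 → ℕ → ℝ) (ψ : ℂ → ℂ) (m : PowerSeries ℂ) (H : Type*)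
    [NormedAddCommGroup H] [InnerProductSpace ℂ H]
    [RKHS ℂ H UnitDisc (EuclideanSpace ℂ (Fin 3))] where
  coeff_a : ∀ s, IsDiagCoeff (a s)
  disc_m : DiscSeries m
  eqOn : Set.EqOn ψ (pw m) (ball 0 1)
  mul_mem : ∀ x, Weighted (a 0) x → Weighted (a 0) (m * x)
  U : H ≃ₗᵢ[ℂ] lp (fun _ : Fin 3 × ℕ => ℂ) 2
  apply_eq' : ∀ (f : H) (z : UnitDisc),
    f z = jet ψ (fun s => pw (lpSeries (a s) (U f) fun n => (s, n))) z

namespace Model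

variable {a : Fin 3 → ℕ → ℝ} {ψ : ℂ → ℂ} {m : PowerSeries ℂ} {H : Type*}
  [NormedAddCommGroup H] [InnerProductSpace ℂ H]
  [RKHS ℂ H UnitDisc (EuclideanSpace ℂ (Fin 3))] (μ : Model a ψ m H)

include μ in
lemma differentiableOn : DifferentiableOn ℂ ψ (ball 0 1) :=
  μ.disc_m.differentiableOn.congr μ.eqOn

/-- The `s`-th power series of an element. -/
def cf (s : Fin 3) : H →ₗ[ℂ] PowerSeries ℂ where
  toFun f := lpSeries (a s) (μ.U f) fun n => (s, n)
  map_add' f g := by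
    ext n
    simp [lpSeries, mul_add]
  map_smul' c f := by
    ext n
    simp [lpSeries]
    ring

lemma coeff_cf (s : Fin 3) (f : H) (n : ℕ) :
    coeff n (μ.cf s f) = (√(a s n) : ℂ) * μ.U f (s, n) := by
  simp [cf, lpSeries]

lemma apply_eq (f : H) (z : UnitDisc) : f z = jet ψ (fun s => pw (μ.cf s f)) z := μ.apply_eq' f z

lemma weighted_cf (s : Fin 3) (f : H) : Weighted (a s) (μ.cf s f) :=
  weighted_lpSeries_fin μ.coeff_a (μ.U f) s

lemma discSeries_cf (s : Fin 3) (f : H) : DiscSeries (μ.cf s f) :=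
  (μ.weighted_cf s f).discSeries (μ.coeff_a s)

lemma cf_ext {f g : H} (h : ∀ s, μ.cf s f = μ.cf s g) : f = g :=
  RKHS.ext fun z => by simp only [μ.apply_eq, h]

lemma cf_eq_of_apply {f : H} {x : Fin 3 → PowerSeries ℂ} (hx : ∀ s, DiscSeries (x s))
    (h : ∀ z : UnitDisc, f z = jet ψ (fun s => pw (x s)) z) (s : Fin 3) : μ.cf s f = x s := by
  have := jet_pw_injective (ψ := ψ) (x := fun s => μ.cf s f) (fun s => μ.discSeries_cf s f) hx
    fun z hz => by
      have h1 := h (UnitDisc.mk z (mem_ball_zero_iff.1 hz))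
      rwa [μ.apply_eq] at h1
  exact congrFun this s

lemma exists_cf_eq {x : Fin 3 → PowerSeries ℂ} (hx : ∀ s, Weighted (a s) (x s)) :
    ∃ f : H, ∀ s, μ.cf s f = x s := by
  have hs : Summable fun i : Fin 3 × ℕ => ‖coeff i.2 (x i.1)‖ ^ 2 / a i.1 i.2 := by
    refine (summable_prod_of_nonneg fun i => ?_).2 ⟨fun s => hx s, Summable.of_finite⟩
    exact div_nonneg (by positivity) ((μ.coeff_a i.1).1 i.2).le
  obtain ⟨c, hc⟩ := exists_lp_of_weighted (a := fun i : Fin 3 × ℕ => a i.1 i.2)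
    (fun i => (μ.coeff_a i.1).1 i.2) hs
  refine ⟨μ.U.symm c, fun s => ?_⟩
  ext n
  rw [coeff_cf, LinearIsometryEquiv.apply_symm_apply]
  exact hc (s, n)

lemma norm_coeff_cf_sq_le (s : Fin 3) (f : H) (n : ℕ) :
    ‖coeff n (μ.cf s f)‖ ^ 2 ≤ a s n * ‖f‖ ^ 2 := by
  rw [coeff_cf, norm_mul, norm_real, Real.norm_of_nonneg (Real.sqrt_nonneg _), mul_pow,
    Real.sq_sqrt ((μ.coeff_a s).1 n).le, ← μ.U.norm_map f]
  have := ((μ.coeff_a s).1 n).le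
  gcongr
  exact lp.norm_apply_le_norm (by simp) (μ.U f) (s, n)

/-- The element whose `s`-th power series is the monomial of degree `n`. -/
def vec (s : Fin 3) (n : ℕ) : H := μ.U.symm (lp.single 2 (s, n) ((√(a s n) : ℂ)⁻¹))

lemma norm_vec_sq (s : Fin 3) (n : ℕ) : ‖μ.vec s n‖ ^ 2 = (a s n)⁻¹ := by
  rw [vec, LinearIsometryEquiv.norm_map, lp.norm_single (by simp), norm_inv, norm_real,
    Real.norm_of_nonneg (Real.sqrt_nonneg _), inv_pow, Real.sq_sqrt ((μ.coeff_a s).1 n).le]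

lemma cf_vec (s t : Fin 3) (n : ℕ) :
    μ.cf t (μ.vec s n) = if t = s then monomial n 1 else 0 := by
  have h0 : (√(a s n) : ℂ) ≠ 0 := ofReal_ne_zero.2 (Real.sqrt_pos.2 ((μ.coeff_a s).1 n)).ne'
  ext k
  rw [coeff_cf, vec, LinearIsometryEquiv.apply_symm_apply, lp.single_apply]
  by_cases hts : t = s
  · subst hts
    by_cases hk : k = n
    · subst hk
      simp [h0]
    · simp [coeff_monomial, hk]
  · simp [hts]

lemma hasSum_vec (f : H) : HasSum (fun i : Fin 3 × ℕ => coeff i.2 (μ.cf i.1 f) • μ.vec i.1 i.2) f := by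
  have h := (lp.hasSum_single (p := 2) (by simp) (μ.U f)).mapL
    (μ.U.symm.toContinuousLinearEquiv : lp (fun _ : Fin 3 × ℕ => ℂ) 2 →L[ℂ] H)
  simp only [ContinuousLinearEquiv.coe_coe, LinearIsometryEquiv.coe_toContinuousLinearEquiv,
    LinearIsometryEquiv.symm_apply_apply] at h
  refine h.congr_fun fun i => ?_
  have h0 : (√(a i.1 i.2) : ℂ) ≠ 0 :=
    ofReal_ne_zero.2 (Real.sqrt_pos.2 ((μ.coeff_a i.1).1 i.2)).ne'
  rw [vec, ← map_smul, ← lp.single_smul, coeff_cf, smul_eq_mul, mul_right_comm,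
    mul_inv_cancel₀ h0, one_mul]

lemma mem_of_vec_mem {E : Submodule ℂ H} (hE : IsClosed (E : Set H)) {f : H}
    (h : ∀ s n, coeff n (μ.cf s f) ≠ 0 → μ.vec s n ∈ E) : f ∈ E := by
  refine hE.mem_of_tendsto (μ.hasSum_vec f) (Filter.Eventually.of_forall fun S =>
    E.sum_mem fun i _ => ?_)
  by_cases hi : coeff i.2 (μ.cf i.1 f) = 0
  · rw [hi, zero_smul]
    exact E.zero_mem
  · exact E.smul_mem _ (h i.1 i.2 hi)

lemma apply_zero (f : H) (z : UnitDisc) : f z 0 = pw (μ.cf 0 f) z := by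
  rw [μ.apply_eq, jet_zero]

lemma apply_one {f : H} (h0 : μ.cf 0 f = 0) (z : UnitDisc) : f z 1 = pw (μ.cf 1 f) z := by
  have h : pw 0 = fun _ => 0 := funext pw_zero
  simp [μ.apply_eq, jet_one, h0, h]

lemma apply_two {f : H} (h0 : μ.cf 0 f = 0) (h1 : μ.cf 1 f = 0) (z : UnitDisc) :
    f z 2 = pw (μ.cf 2 f) z := by
  have h : pw 0 = fun _ => 0 := funext pw_zero
  simp [μ.apply_eq, jet_two, h0, h1, h]

/-! ### Multiplication by the coordinate on triples -/

section MulZ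

variable {M : H →L[ℂ] H} (hM : IsMulZ M)
include hM

lemma cf_mulZ (f : H) (s : Fin 3) : μ.cf s (M f) =
    ![X * μ.cf 0 f, X * μ.cf 1 f + μ.cf 0 f, X * μ.cf 2 f + μ.cf 1 f + m * μ.cf 0 f] s := by
  have hd (s) := μ.discSeries_cf s f
  have hX (s) := (hd s).X_mul
  have hm0 := μ.disc_m.mul (hd 0)
  refine μ.cf_eq_of_apply (fun s => ?_) (fun z => ?_) s
  · fin_cases s
    · exact hX 0
    · exact (hX 1).add (hd 0)
    · exact ((hX 2).add (hd 1)).add hm0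
  · have hz := mem_ball_zero_iff.2 z.norm_lt_one
    rw [hM f z, μ.apply_eq, ← jet_mul_id μ.differentiableOn
      (fun s => (μ.discSeries_cf s f).differentiableOn) hz]
    refine jet_congr (fun _ _ => rfl) (fun s u hu => ?_) hz
    fin_cases s
    · simp [(hd 0).pw_X_mul hu]
    · simp [(hX 1).pw_add (hd 0) hu, (hd 1).pw_X_mul hu]
    · simp [((hX 2).add (hd 1)).pw_add hm0 hu, (hX 2).pw_add (hd 1) hu, (hd 2).pw_X_mul hu,
        μ.disc_m.pw_mul (hd 0) hu, μ.eqOn hu]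

lemma cf_zero_mulZ (f : H) : μ.cf 0 (M f) = X * μ.cf 0 f := μ.cf_mulZ hM f 0

lemma cf_one_mulZ (f : H) : μ.cf 1 (M f) = X * μ.cf 1 f + μ.cf 0 f := μ.cf_mulZ hM f 1

lemma cf_two_mulZ (f : H) : μ.cf 2 (M f) = X * μ.cf 2 f + μ.cf 1 f + m * μ.cf 0 f :=
  μ.cf_mulZ hM f 2

lemma mulZ_vec_two (n : ℕ) : M (μ.vec 2 n) = μ.vec 2 (n + 1) := by
  refine μ.cf_ext fun s => ?_
  fin_cases s <;> simp [cf_zero_mulZ, cf_one_mulZ, cf_two_mulZ, hM, cf_vec, X_eq,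
    monomial_mul_monomial, add_comm]

lemma mulZ_vec_one (n : ℕ) : M (μ.vec 1 n) = μ.vec 1 (n + 1) + μ.vec 2 n := by
  refine μ.cf_ext fun s => ?_
  fin_cases s <;> simp [cf_zero_mulZ, cf_one_mulZ, cf_two_mulZ, hM, cf_vec, X_eq,
    monomial_mul_monomial, add_comm]

lemma cf_mulZ_vec_zero (n : ℕ) (s : Fin 3) : μ.cf s (M (μ.vec 0 n) - μ.vec 0 (n + 1)) =
    ![0, monomial n 1, m * monomial n 1] s := by
  fin_cases s <;> simp [cf_zero_mulZ, cf_one_mulZ, cf_two_mulZ, hM, cf_vec, X_eq,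
    monomial_mul_monomial, add_comm]

/-- The three constants generate the space under M: slot 2 is filled first, then slot 1 modulo slot
2, then slot 0 modulo both. -/
lemma eq_top_of_invariant {E : Submodule ℂ H} (hE : IsClosed (E : Set H))
    (hME : ∀ f ∈ E, M f ∈ E) (h0 : ∀ s, μ.vec s 0 ∈ E) (f : H) : f ∈ E := by
  have h2 (n : ℕ) : μ.vec 2 n ∈ E := by
    induction n with
    | zero => exact h0 2
    | succ n ih => exact μ.mulZ_vec_two hM n ▸ hME _ ih
  have h1 (n : ℕ) : μ.vec 1 n ∈ E := by
    induction n with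
    | zero => exact h0 1
    | succ n ih =>
      rw [← sub_eq_of_eq_add (μ.mulZ_vec_one hM n)]
      exact E.sub_mem (hME _ ih) (h2 n)
  have h3 (n : ℕ) : μ.vec 0 n ∈ E := by
    induction n with
    | zero => exact h0 0
    | succ n ih =>
      -- The slot-2 part m·zⁿ is an infinite series, so closedness of E is needed here.
      have h4 : M (μ.vec 0 n) - μ.vec 0 (n + 1) ∈ E := by
        refine μ.mem_of_vec_mem hE fun s k hk => ?_
        rw [cf_mulZ_vec_zero _ hM] at hk
        fin_cases s
        · simp at hk
        · exact h1 k
        · exact h2 k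
      rw [← sub_sub_cancel (M (μ.vec 0 n)) (μ.vec 0 (n + 1))]
      exact E.sub_mem (hME _ ih) h4
  refine μ.mem_of_vec_mem hE fun s n _ => ?_
  fin_cases s
  exacts [h3 n, h1 n, h2 n]

end MulZ

end Model

lemma pw_one : pw 1 = fun _ => 1 := by
  funext z
  simpa using pw_monomial 0 1 z

lemma coeff_two_X_sq_mul (x : PowerSeries ℂ) : coeff 2 (X ^ 2 * x) = coeff 0 x :=
  coeff_X_pow_mul x 2 0

/-! ### Estimates and values of the basis vectors -/

namespace Model

variable {a a' : Fin 3 → ℕ → ℝ} {ψ ψ' : ℂ → ℂ} {m m' : PowerSeries ℂ} {H H' : Type*}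
  [NormedAddCommGroup H] [InnerProductSpace ℂ H]
  [RKHS ℂ H UnitDisc (EuclideanSpace ℂ (Fin 3))]
  [NormedAddCommGroup H'] [InnerProductSpace ℂ H']
  [RKHS ℂ H' UnitDisc (EuclideanSpace ℂ (Fin 3))]
  (μ : Model a ψ m H) (μ' : Model a' ψ' m' H')

/-- The vector has squared norm 1/a', and the k-th coefficient functional has squared norm at most
a. -/
lemma norm_coeff_cf_map_vec (A : H' →L[ℂ] H) (s t : Fin 3) (n k : ℕ) :
    ‖coeff k (μ.cf s (A (μ'.vec t n)))‖ ^ 2 * a' t n ≤ ‖A‖ ^ 2 * a s k := by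
  have hn := (μ'.coeff_a t).1 n
  have h1 := μ.norm_coeff_cf_sq_le s (A (μ'.vec t n)) k
  have h2 : ‖A (μ'.vec t n)‖ ^ 2 ≤ ‖A‖ ^ 2 * (a' t n)⁻¹ := by
    rw [← μ'.norm_vec_sq, ← mul_pow]
    gcongr
    exact A.le_opNorm _
  have h3 := mul_le_mul_of_nonneg_left h2 ((μ.coeff_a s).1 k).le
  rw [← le_div_iff₀ hn]
  calc _ ≤ _ := h1
    _ ≤ _ := h3
    _ = _ := by ring

include μ in
lemma le_succ {M : H →L[ℂ] H} (hM : IsMulZ M) (s : Fin 3) (n : ℕ) :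
    a s n ≤ ‖M‖ ^ 2 * a s (n + 1) := by
  have h := μ.norm_coeff_cf_map_vec μ M s s n (n + 1)
  have h1 : coeff (n + 1) (μ.cf s (M (μ.vec s n))) = 1 := by
    rw [μ.cf_mulZ hM]
    fin_cases s <;> simp [cf_vec, coeff_succ_X_mul]
  simpa [h1] using h

include μ in
-- M puts a copy of zⁿ from slot 0 into slot 1. This comparison lets the shear move slot 0 into slot
-- 1.
lemma zero_le_one {M : H →L[ℂ] H} (hM : IsMulZ M) (n : ℕ) :
    a 0 n ≤ ‖M‖ ^ 2 * a 1 n := by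
  have h := μ.norm_coeff_cf_map_vec μ M 1 0 n n
  have h1 : coeff n (μ.cf 1 (M (μ.vec 0 n))) = 1 := by
    rw [μ.cf_one_mulZ hM]
    simp [cf_vec]
  simpa [h1] using h

lemma vec_apply_zero (s : Fin 3) (z : UnitDisc) : μ.vec s 0 z 0 = if s = 0 then 1 else 0 := by
  rw [μ.apply_zero, cf_vec]
  fin_cases s <;> simp [pw_one]

lemma vec_apply_one (s : Fin 3) (z : UnitDisc) : μ.vec s 0 z 1 = if s = 1 then 1 else 0 := by
  have h0 : pw 0 = fun _ => 0 := funext pw_zero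
  rw [μ.apply_eq, jet_one]
  fin_cases s <;> simp [cf_vec, pw_one, h0]

lemma vec_apply_two {s : Fin 3} (hs : s ≠ 0) (z : UnitDisc) :
    μ.vec s 0 z 2 = if s = 2 then 1 else 0 := by
  have h0 : pw 0 = fun _ => 0 := funext pw_zero
  rw [μ.apply_eq, jet_two]
  fin_cases s
  · exact (hs rfl).elim
  all_goals simp [cf_vec, pw_one, h0]

include μ in
-- The values at z of the three constants form a triangular basis of ℂ³.
lemma eq_zero_of_inner_apply {ξ : EuclideanSpace ℂ (Fin 3)} (z : UnitDisc)
    (h : ∀ f : H, ⟪ξ, f z⟫_ℂ = 0) : ξ = 0 := by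
  have h2 : ξ 2 = 0 := by
    simpa [PiLp.inner_apply, Fin.sum_univ_three, vec_apply_zero, vec_apply_one, vec_apply_two]
      using h (μ.vec 2 0)
  have h1 : ξ 1 = 0 := by
    simpa [PiLp.inner_apply, Fin.sum_univ_three, vec_apply_zero, vec_apply_one, vec_apply_two]
      using h (μ.vec 1 0)
  have h0 : ξ 0 = 0 := by
    simpa [PiLp.inner_apply, Fin.sum_univ_three, vec_apply_zero, vec_apply_one, h2]
      using h (μ.vec 0 0)
  ext j
  fin_cases j <;> assumption

/-- Evaluation at a point. -/
def evalCLM (H : Type*) [NormedAddCommGroup H] [InnerProductSpace ℂ H]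
    [RKHS ℂ H UnitDisc (EuclideanSpace ℂ (Fin 3))] (z : UnitDisc) :
    H →L[ℂ] EuclideanSpace ℂ (Fin 3) :=
  .proj z ∘L RKHS.coeCLM (X := UnitDisc) (V := EuclideanSpace ℂ (Fin 3)) (H := H) ℂ

lemma evalCLM_apply (z : UnitDisc) (f : H) :
    evalCLM H z f = f z := rfl

/-! ### Structure of intertwiners -/

section Intertwining

variable {M : H →L[ℂ] H} {M' : H' →L[ℂ] H'} (hM : IsMulZ M) (hM' : IsMulZ M')
  {A : H' →L[ℂ] H} (hA : A ∘L M' = M ∘L A)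
include hM hM' hA

omit hM hM' in
omit [RKHS ℂ H UnitDisc (EuclideanSpace ℂ (Fin 3))]
  [RKHS ℂ H' UnitDisc (EuclideanSpace ℂ (Fin 3))] in
lemma map_mulZ (f : H') : A (M' f) = M (A f) := DFunLike.congr_fun hA f

/-- An intertwiner is the multiplication by a matrix valued function. -/
lemma map_apply (z : UnitDisc) : ∃ c : ℂ, ∀ f : H', A f z =
    f z 0 • (A (μ'.vec 0 0) z + c • A (μ'.vec 2 0) z) + f z 1 • A (μ'.vec 1 0) z
      + f z 2 • A (μ'.vec 2 0) z := by
  -- The jet of the constant in slot 0 is e₀ plus a multiple of e₂ coming from the derivative of ψ';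
  -- c removes that multiple.
  refine ⟨-μ'.vec 0 0 z 2, fun f => ?_⟩
  set c := -μ'.vec 0 0 z 2 with hc
  let L (j : Fin 3) (v : EuclideanSpace ℂ (Fin 3)) : H' →L[ℂ] EuclideanSpace ℂ (Fin 3) :=
    (EuclideanSpace.proj j ∘L evalCLM H' z).smulRight v
  let D : H' →L[ℂ] EuclideanSpace ℂ (Fin 3) := evalCLM H z ∘L A
    - (L 0 (A (μ'.vec 0 0) z + c • A (μ'.vec 2 0) z) + L 1 (A (μ'.vec 1 0) z)
      + L 2 (A (μ'.vec 2 0) z))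
  have hD (g : H') : D g = A g z - (g z 0 • (A (μ'.vec 0 0) z + c • A (μ'.vec 2 0) z)
      + g z 1 • A (μ'.vec 1 0) z + g z 2 • A (μ'.vec 2 0) z) := by
    simp [D, L, evalCLM_apply]
  -- The kernel of D is closed, and it is invariant because both parts of D are multiplied by z
  -- under M'.
  have h := μ'.eq_top_of_invariant hM' (E := (D : H' →ₗ[ℂ] EuclideanSpace ℂ (Fin 3)).ker) D.isClosed_ker
    (fun g hg => ?_) (fun s => ?_) f
  · rw [LinearMap.mem_ker, ContinuousLinearMap.coe_coe, hD, sub_eq_zero] at h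
    exact h
  · rw [LinearMap.mem_ker, ContinuousLinearMap.coe_coe, hD] at hg ⊢
    have h1 : A (M' g) z = (z : ℂ) • A g z := by rw [map_mulZ hA, hM]
    rw [h1, hM', sub_eq_zero.1 hg]
    simp only [PiLp.smul_apply, smul_eq_mul]
    module
  · rw [LinearMap.mem_ker, ContinuousLinearMap.coe_coe, hD]
    fin_cases s
    · simp [vec_apply_zero, vec_apply_one, hc]
    · simp [vec_apply_zero, vec_apply_one, vec_apply_two]
    · simp [vec_apply_zero, vec_apply_one, vec_apply_two]

/-- The matrix of an intertwiner whose adjoint is injective is invertible. -/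
lemma det_ne_zero
    (hinj : ∀ (z : UnitDisc) (ξ : EuclideanSpace ℂ (Fin 3)), (∀ f, ⟪ξ, A f z⟫_ℂ = 0) → ξ = 0) :
    Matrix.det !![A (μ'.vec 0 0) 0 0, A (μ'.vec 0 0) 0 1, A (μ'.vec 0 0) 0 2;
      A (μ'.vec 1 0) 0 0, A (μ'.vec 1 0) 0 1, A (μ'.vec 1 0) 0 2;
      A (μ'.vec 2 0) 0 0, A (μ'.vec 2 0) 0 1, A (μ'.vec 2 0) 0 2] ≠ 0 := by
  intro h
  obtain ⟨v, hv, hN⟩ := Matrix.exists_mulVec_eq_zero_iff.2 h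
  -- The conjugated null vector is orthogonal to the images of the constants at 0, hence by
  -- `map_apply` to all values A f 0.
  have hrow (s : Fin 3) : ⟪WithLp.toLp 2 (fun j => conj (v j)), A (μ'.vec s 0) 0⟫_ℂ = 0 := by
    have h1 := congrFun hN s
    fin_cases s <;>
      simpa [PiLp.inner_apply, Fin.sum_univ_three, Matrix.mulVec, dotProduct] using h1
  have h0 := hinj 0 (WithLp.toLp 2 (fun j => conj (v j))) fun f => by
    obtain ⟨c, hc⟩ := μ'.map_apply hM hM' hA 0
    rw [hc]
    simp only [inner_add_right, inner_smul_right, hrow, mul_zero, add_zero]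
  refine hv (funext fun j => ?_)
  simpa using congrFun (congrArg WithLp.ofLp h0) j

/-- Such an f takes values in ℂe₂, so A f is pointwise a multiple of the image of the constant in
slot 2. -/
lemma cf_zero_map_eq_zero (h2 : μ.cf 0 (A (μ'.vec 2 0)) = 0) {f : H'} (h0 : μ'.cf 0 f = 0)
    (h1 : μ'.cf 1 f = 0) : μ.cf 0 (A f) = 0 := by
  refine (μ.discSeries_cf 0 _).eq_of_pw_eq discSeries_zero fun z hz => ?_
  obtain ⟨c, hc⟩ := μ'.map_apply hM hM' hA (UnitDisc.mk z (mem_ball_zero_iff.1 hz))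
  have h := congrArg (fun v : EuclideanSpace ℂ (Fin 3) => v 0) (hc f)
  simpa [μ.apply_zero, μ'.apply_zero, μ'.apply_one h0, h0, h1, h2] using h

/-- The first row of an intertwiner satisfies a quadratic bound. -/
lemma quadBound_zero : QuadBound (X ^ 2 * μ.cf 0 (A (μ'.vec 0 0)))
    (-(X * μ.cf 0 (A (M' (μ'.vec 0 0) - μ'.vec 0 1)))) (μ.cf 0 (A (μ'.vec 2 0)))
    (a' 0) (a 0) := by
  -- M' maps zⁿ in slot 0 to zⁿ⁺¹ in slot 0 plus a remainder in slots 1 and 2. The sequence y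
  -- follows this remainder, whose own recursion leaves only zⁿ in slot 2.
  refine quadBound_of_recursion (x := fun n => μ.cf 0 (A (μ'.vec 0 n)))
    (y := fun n => μ.cf 0 (A (M' (μ'.vec 0 n) - μ'.vec 0 (n + 1))))
    (z := fun n => μ.cf 0 (A (μ'.vec 2 n))) (fun n => ?_) (fun n => ?_) (fun n => ?_)
    (fun n k => μ.norm_coeff_cf_map_vec μ' A 0 0 n k)
  · rw [← μ'.mulZ_vec_two hM', map_mulZ hA, μ.cf_zero_mulZ hM]
  · have h : M' (μ'.vec 0 (n + 1)) - μ'.vec 0 (n + 1 + 1)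
        = M' (M' (μ'.vec 0 n) - μ'.vec 0 (n + 1)) - μ'.vec 2 n := by
      refine μ'.cf_ext fun s => ?_
      rw [cf_mulZ_vec_zero _ hM', map_sub, cf_mulZ _ hM']
      simp only [cf_mulZ_vec_zero _ hM', cf_vec]
      fin_cases s
      · simp
      · simp [X_eq, monomial_mul_monomial, add_comm]
      · have : (monomial (n + 1) (1 : ℂ)) = X * monomial n 1 := by
          simp [X_eq, monomial_mul_monomial, add_comm]
        simp [this]
        ring
    rw [h, map_sub, map_mulZ hA, map_sub, μ.cf_zero_mulZ hM]
  · simp only [map_sub, map_mulZ hA, μ.cf_zero_mulZ hM, sub_sub_cancel]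

/-- The third column of an intertwiner satisfies a quadratic bound. -/
lemma quadBound_two : QuadBound (X ^ 2 * μ.cf 2 (A (μ'.vec 2 0)))
    (-(X * -(μ.cf 1 (A (μ'.vec 2 0)) + m * μ.cf 0 (A (μ'.vec 2 0))))) (μ.cf 0 (A (μ'.vec 2 0)))
    (a' 2) (a 2) := by
  -- Taking the term m·(first series) into y closes the recursion, since m commutes with X.
  refine quadBound_of_recursion (x := fun n => μ.cf 2 (A (μ'.vec 2 n)))
    (y := fun n => -(μ.cf 1 (A (μ'.vec 2 n)) + m * μ.cf 0 (A (μ'.vec 2 n))))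
    (z := fun n => μ.cf 0 (A (μ'.vec 2 n))) (fun n => ?_) (fun n => ?_) (fun n => ?_)
    (fun n k => μ.norm_coeff_cf_map_vec μ' A 2 2 n k)
  · rw [← μ'.mulZ_vec_two hM', map_mulZ hA, μ.cf_zero_mulZ hM]
  · simp only [← μ'.mulZ_vec_two hM', map_mulZ hA, μ.cf_zero_mulZ hM, μ.cf_one_mulZ hM]
    ring
  · simp only [← μ'.mulZ_vec_two hM', map_mulZ hA, μ.cf_two_mulZ hM]
    ring

variable (hinj : ∀ (z : UnitDisc) (ξ : EuclideanSpace ℂ (Fin 3)),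
  (∀ f, ⟪ξ, A f z⟫_ℂ = 0) → ξ = 0)

omit hM hM' hA in
lemma third_column (h : -(X * -(μ.cf 1 (A (μ'.vec 2 0)) + m * μ.cf 0 (A (μ'.vec 2 0)))) = 0 ∧
    μ.cf 0 (A (μ'.vec 2 0)) = 0) : μ.cf 1 (A (μ'.vec 2 0)) = 0 := by
  simpa [X_ne_zero, h.2] using h.1

/-- The remainder of M' on the constant in slot 0 differs from the constant in slot 1 only in slot
2, which contributes nothing to the first series. -/
lemma first_row (h : -(X * μ.cf 0 (A (M' (μ'.vec 0 0) - μ'.vec 0 1))) = 0 ∧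
    μ.cf 0 (A (μ'.vec 2 0)) = 0) : μ.cf 0 (A (μ'.vec 1 0)) = 0 := by
  have h1 : μ.cf 0 (A (M' (μ'.vec 0 0) - μ'.vec 0 1)) = 0 := by
    simpa [X_ne_zero] using h.1
  have h2 := μ.cf_zero_map_eq_zero μ' hM hM' hA h.2
    (f := M' (μ'.vec 0 0) - μ'.vec 0 1 - μ'.vec 1 0)
    (by rw [map_sub, cf_mulZ_vec_zero _ hM', cf_vec]; simp)
    (by rw [map_sub, cf_mulZ_vec_zero _ hM', cf_vec]; simp)
  rw [map_sub, map_sub, h1, zero_sub, neg_eq_zero] at h2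
  exact h2

include hinj

/-- The other entries of the first row vanish, so the constant term in question is a factor of the
nonzero determinant. -/
lemma first_row_ne_zero (h : -(X * μ.cf 0 (A (M' (μ'.vec 0 0) - μ'.vec 0 1))) = 0 ∧
    μ.cf 0 (A (μ'.vec 2 0)) = 0) : coeff 2 (X ^ 2 * μ.cf 0 (A (μ'.vec 0 0))) ≠ 0 := by
  have h1 := μ.first_row μ' hM hM' hA h
  intro h0
  rw [coeff_two_X_sq_mul] at h0
  refine μ'.det_ne_zero hM hM' hA hinj ?_
  simp [Matrix.det_fin_three, μ.apply_zero, h1, h.2, pw_zero_right, h0]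

/-- The other entries of the third column vanish, so this constant term also divides the
determinant. -/
lemma third_column_ne_zero
    (h : -(X * -(μ.cf 1 (A (μ'.vec 2 0)) + m * μ.cf 0 (A (μ'.vec 2 0)))) = 0 ∧
      μ.cf 0 (A (μ'.vec 2 0)) = 0) : coeff 2 (X ^ 2 * μ.cf 2 (A (μ'.vec 2 0))) ≠ 0 := by
  have h1 := μ.third_column μ' h
  intro h0
  rw [coeff_two_X_sq_mul] at h0
  refine μ'.det_ne_zero hM hM' hA hinj ?_
  simp [Matrix.det_fin_three, μ.apply_zero, μ.apply_one h.2, μ.apply_two h.2 h1, h1, h.2,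
    pw_zero_right, h0]

/-- The weights in the middle are comparable if the intertwiner is triangular. -/
lemma middle_le (h02 : μ.cf 0 (A (μ'.vec 2 0)) = 0) (h12 : μ.cf 1 (A (μ'.vec 2 0)) = 0)
    (h01 : μ.cf 0 (A (μ'.vec 1 0)) = 0) : ∃ C : ℝ, ∀ n, a' 1 n ≤ C * a 1 n := by
  have hne : coeff 0 (μ.cf 1 (A (μ'.vec 1 0))) ≠ 0 := by
    intro h0
    refine μ'.det_ne_zero hM hM' hA hinj ?_
    simp only [Matrix.det_fin_three]
    simp [μ.apply_zero, μ.apply_one h02, μ.apply_one h01, h12, h02, h01, pw_zero_right, h0]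
  have h2 (n : ℕ) : μ.cf 0 (A (μ'.vec 2 n)) = 0 ∧ μ.cf 1 (A (μ'.vec 2 n)) = 0 := by
    induction n with
    | zero => exact ⟨h02, h12⟩
    | succ n ih =>
      rw [← μ'.mulZ_vec_two hM', map_mulZ hA, μ.cf_zero_mulZ hM, μ.cf_one_mulZ hM, ih.1, ih.2]
      simp
  -- Triangularity removes the slot-2 correction, so the middle entry merely shifts and its constant
  -- term appears at index n.
  have h1 (n : ℕ) : μ.cf 0 (A (μ'.vec 1 n)) = 0 ∧
      μ.cf 1 (A (μ'.vec 1 n)) = X ^ n * μ.cf 1 (A (μ'.vec 1 0)) := by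
    induction n with
    | zero => exact ⟨h01, by simp⟩
    | succ n ih =>
      rw [← sub_eq_of_eq_add (μ'.mulZ_vec_one hM' n), map_sub, map_mulZ hA, map_sub, map_sub,
        μ.cf_zero_mulZ hM, μ.cf_one_mulZ hM, ih.1, ih.2, (h2 n).1, (h2 n).2]
      exact ⟨by simp, by ring⟩
  set b := coeff 0 (μ.cf 1 (A (μ'.vec 1 0))) with hb
  have hb' : 0 < ‖b‖ ^ 2 := by positivity
  refine ⟨‖A‖ ^ 2 / ‖b‖ ^ 2, fun n => ?_⟩
  have h := μ.norm_coeff_cf_map_vec μ' A 1 1 n n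
  have hn : coeff n (X ^ n * μ.cf 1 (A (μ'.vec 1 0))) = b := by
    have := coeff_X_pow_mul (μ.cf 1 (A (μ'.vec 1 0))) n 0
    rwa [zero_add] at this
  rw [(h1 n).2, hn] at h
  rw [div_mul_eq_mul_div, le_div_iff₀ hb']
  linarith

end Intertwining

end Model

/-! ### From comparable weights to similarity -/

namespace Model

variable {a a' : Fin 3 → ℕ → ℝ} {ψ ψ' : ℂ → ℂ} {m m' : PowerSeries ℂ} {H H' : Type*}
  [NormedAddCommGroup H] [InnerProductSpace ℂ H]
  [RKHS ℂ H UnitDisc (EuclideanSpace ℂ (Fin 3))]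
  [NormedAddCommGroup H'] [InnerProductSpace ℂ H']
  [RKHS ℂ H' UnitDisc (EuclideanSpace ℂ (Fin 3))]
  (μ : Model a ψ m H) (μ' : Model a' ψ' m' H')
  {M : H →L[ℂ] H} {M' : H' →L[ℂ] H'}

include μ μ' in
/-- Intertwiners in both directions whose adjoints are injective force comparable weights. -/
theorem weights_le (hM : IsMulZ M) (hM' : IsMulZ M') {A : H' →L[ℂ] H} {B : H →L[ℂ] H'}
    (hA : A ∘L M' = M ∘L A) (hB : B ∘L M = M' ∘L B)
    (hAi : ∀ (z : UnitDisc) (ξ : EuclideanSpace ℂ (Fin 3)), (∀ f, ⟪ξ, A f z⟫_ℂ = 0) → ξ = 0)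
    (hBi : ∀ (z : UnitDisc) (ξ : EuclideanSpace ℂ (Fin 3)), (∀ f, ⟪ξ, B f z⟫_ℂ = 0) → ξ = 0)
    (s : Fin 3) : ∃ C : ℝ, ∀ n, a' s n ≤ C * a s n := by
  have hD (s) : ∃ D, ∀ n, a s n ≤ D * a s (n + 1) := ⟨_, μ.le_succ hM s⟩
  have hD' (s) : ∃ D, ∀ n, a' s n ≤ D * a' s (n + 1) := ⟨_, μ'.le_succ hM' s⟩
  have q0 := μ.quadBound_zero μ' hM hM' hA
  have q2 := μ.quadBound_two μ' hM hM' hA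
  have h0 := q0.eq_zero (μ'.quadBound_zero μ hM' hM hB) (μ.coeff_a 0) (μ'.coeff_a 0) (hD 0) (hD' 0)
    (μ'.first_row_ne_zero μ hM' hM hB hBi)
  have h2 := q2.eq_zero (μ'.quadBound_two μ hM' hM hB) (μ.coeff_a 2) (μ'.coeff_a 2) (hD 2) (hD' 2)
    (μ'.third_column_ne_zero μ hM' hM hB hBi)
  fin_cases s
  · exact q0.exists_le h0 (μ.first_row_ne_zero μ' hM hM' hA hAi h0)
  · exact μ.middle_le μ' hM hM' hA hAi h0.2 (μ.third_column μ' h2) (μ.first_row μ' hM hM' hA h0)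
  · exact q2.exists_le h2 (μ.third_column_ne_zero μ' hM hM' hA hAi h2)

/-- The operator `v ↦ v + (ψ(z) - ψ'(z)) v₀ e₁`. -/
def shear (ψ ψ' : ℂ → ℂ) (z : UnitDisc) :
    EuclideanSpace ℂ (Fin 3) →L[ℂ] EuclideanSpace ℂ (Fin 3) :=
  .id ℂ _ + (EuclideanSpace.proj (0 : Fin 3)).smulRight
    ((ψ z - ψ' z) • EuclideanSpace.single (1 : Fin 3) (1 : ℂ))

lemma shear_apply (ψ ψ' : ℂ → ℂ) (z : UnitDisc) (v : EuclideanSpace ℂ (Fin 3)) :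
    shear ψ ψ' z v = v + ((ψ z - ψ' z) * v 0) • EuclideanSpace.single 1 1 := by
  simp [shear, smul_smul, mul_comm]

lemma shear_shear (ψ ψ' : ℂ → ℂ) (z : UnitDisc) (v : EuclideanSpace ℂ (Fin 3)) :
    shear ψ' ψ z (shear ψ ψ' z v) = v := by
  ext j
  fin_cases j <;> simp [shear_apply]
  ring

include μ μ' in
/-- Comparable weights give the same space up to the shear. -/
lemma exists_shear [CompleteSpace H] [CompleteSpace H'] (hM' : IsMulZ M')
    (h : ∀ s, ∃ C : ℝ, ∀ n, a s n ≤ C * a' s n) :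
    ∃ L : H →L[ℂ] H', ∀ f z, L f z = shear ψ ψ' z (f z) := by
  have hw (s) {x : PowerSeries ℂ} (hx : Weighted (a s) x) : Weighted (a' s) x :=
    hx.of_le (μ.coeff_a s).1 (μ'.coeff_a s).1 (h s).choose_spec
  refine exists_continuousLinearMap_of_mapsTo (shear ψ ψ') fun f => ?_
  have hx (s) := μ.weighted_cf s f
  -- Each product is formed where its multiplier acts: m in the weight a, m' in the weight a'. The
  -- difference then passes from slot 0 to slot 1 by `zero_le_one`.
  have hy : Weighted (a' 0) (m * μ.cf 0 f + -(m' * μ.cf 0 f)) :=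
    Weighted.add (μ'.coeff_a 0).1 (hw 0 (μ.mul_mem _ (hx 0)))
      (μ'.mul_mem _ (hw 0 (hx 0))).neg
  have hy' : Weighted (a' 1) (m * μ.cf 0 f + -(m' * μ.cf 0 f)) :=
    hy.of_le (μ'.coeff_a 0).1 (μ'.coeff_a 1).1 (μ'.zero_le_one hM')
  obtain ⟨g, hg⟩ := μ'.exists_cf_eq
    (x := ![μ.cf 0 f, μ.cf 1 f + (m * μ.cf 0 f + -(m' * μ.cf 0 f)), μ.cf 2 f]) fun s => by
      fin_cases s
      · exact hw 0 (hx 0)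
      · exact Weighted.add (μ'.coeff_a 1).1 (hw 1 (hx 1)) hy'
      · exact hw 2 (hx 2)
  have hd (s) := μ.discSeries_cf s f
  refine ⟨g, fun z => ?_⟩
  have hz := mem_ball_zero_iff.2 z.norm_lt_one
  rw [shear_apply, μ.apply_eq, ← jet_change μ.differentiableOn μ'.differentiableOn
    (fun s => (hd s).differentiableOn) hz, μ'.apply_eq]
  refine jet_congr (fun _ _ => rfl) (fun s u hu => ?_) hz
  rw [hg]
  fin_cases s
  · rfl
  · have h1 := μ.disc_m.mul (hd 0)
    have h2 := μ'.disc_m.mul (hd 0)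
    have h3 := μ'.eqOn hu
    have h4 := (h1.sub h2).pw_add h2 hu
    rw [sub_add_cancel, μ.disc_m.pw_mul (hd 0) hu, μ'.disc_m.pw_mul (hd 0) hu, ← μ.eqOn hu,
      ← μ'.eqOn hu] at h4
    simp only [Fin.mk_one, Matrix.cons_val_one, Matrix.cons_val_zero, ← sub_eq_add_neg]
    rw [(hd 1).pw_add (h1.sub h2) hu]
    linear_combination -h4
  · rfl

include μ μ' in
-- The shears for (ψ, ψ') and (ψ', ψ) are mutually inverse, and pointwise linear maps commute with
-- multiplication by z.
theorem exists_similarity [CompleteSpace H] [CompleteSpace H'] (hM : IsMulZ M) (hM' : IsMulZ M')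
    (h : ∀ s, ∃ C : ℝ, ∀ n, a s n ≤ C * a' s n) (h' : ∀ s, ∃ C : ℝ, ∀ n, a' s n ≤ C * a s n) :
    ∃ S : H' ≃L[ℂ] H, (S : H' →L[ℂ] H) ∘L M' = M ∘L S := by
  obtain ⟨L, hL⟩ := μ.exists_shear μ' hM' h
  obtain ⟨L', hL'⟩ := μ'.exists_shear μ hM h'
  refine ⟨ContinuousLinearEquiv.equivOfInverse L' L (fun f => ?_) (fun f => ?_), ?_⟩
  · exact RKHS.ext fun z => by rw [hL, hL', shear_shear]
  · exact RKHS.ext fun z => by rw [hL', hL, shear_shear]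
  · ext f : 1
    refine RKHS.ext fun z => ?_
    change L' (M' f) z = M (L' f) z
    rw [hL', hM', hM, hL', map_smul]

omit [RKHS ℂ H' UnitDisc (EuclideanSpace ℂ (Fin 3))] in
include μ in
-- The hypothesis says that X annihilates the kernel function at z in direction ξ; as X is
-- injective, this function is zero, and the values of H at z span ℂ³.
lemma inner_adjoint_apply_injective [CompleteSpace H] [CompleteSpace H'] {X : H →L[ℂ] H'}
    (hX : Function.Injective X) (z : UnitDisc) (ξ : EuclideanSpace ℂ (Fin 3))
    (h : ∀ f, ⟪ξ, X.adjoint f z⟫_ℂ = 0) : ξ = 0 := by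
  have h1 : X (RKHS.kerFun H z ξ) = 0 := by
    refine ext_inner_right ℂ fun f => ?_
    rw [inner_zero_left, ← ContinuousLinearMap.adjoint_inner_right, RKHS.kerFun_inner, h]
  have h2 : RKHS.kerFun H z ξ = 0 := hX (h1.trans (map_zero X).symm)
  refine μ.eq_zero_of_inner_apply z fun f => ?_
  rw [← RKHS.kerFun_inner, h2, inner_zero_left]

include μ μ' in
theorem similar_of_quasiSimilar [CompleteSpace H] [CompleteSpace H'] (hM : IsMulZ M)
    (hM' : IsMulZ M') (h : QuasiSimilar M.adjoint M'.adjoint) :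
    Similar M.adjoint M'.adjoint := by
  obtain ⟨X, Y, hX, hY, hXM, hYM⟩ := h
  have hA : X.adjoint ∘L M' = M ∘L X.adjoint := by
    have := congrArg ContinuousLinearMap.adjoint hXM
    simpa only [ContinuousLinearMap.adjoint_comp, ContinuousLinearMap.adjoint_adjoint]
      using this.symm
  have hB : Y.adjoint ∘L M = M' ∘L Y.adjoint := by
    have := congrArg ContinuousLinearMap.adjoint hYM
    simpa only [ContinuousLinearMap.adjoint_comp, ContinuousLinearMap.adjoint_adjoint] using this
  have hAi := μ.inner_adjoint_apply_injective hX.1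
  have hBi := μ'.inner_adjoint_apply_injective hY.1
  obtain ⟨S, hS⟩ := μ.exists_similarity μ' hM hM' (μ'.weights_le μ hM' hM hB hA hBi hAi)
    (μ.weights_le μ' hM hM' hA hB hAi hBi)
  -- The similarity was built for M and M'; adjoints of S and its inverse carry it to the adjoint
  -- operators.
  have h1 : (S : H' →L[ℂ] H) ∘L (S.symm : H →L[ℂ] H') = .id ℂ H := by ext; simp
  have h2 : (S.symm : H →L[ℂ] H') ∘L (S : H' →L[ℂ] H) = .id ℂ H' := by ext; simp
  replace h1 := congrArg ContinuousLinearMap.adjoint h1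
  replace h2 := congrArg ContinuousLinearMap.adjoint h2
  replace hS := congrArg ContinuousLinearMap.adjoint hS
  rw [ContinuousLinearMap.adjoint_comp, ContinuousLinearMap.adjoint_id] at h1 h2
  rw [ContinuousLinearMap.adjoint_comp, ContinuousLinearMap.adjoint_comp] at hS
  exact ⟨ContinuousLinearEquiv.equivOfInverse (S : H' →L[ℂ] H).adjoint
    (S.symm : H →L[ℂ] H').adjoint (DFunLike.congr_fun h1)
    (DFunLike.congr_fun h2), hS.symm⟩

end Model

theorem Similar.quasiSimilar {H H' : Type*} [NormedAddCommGroup H] [InnerProductSpace ℂ H]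
    [NormedAddCommGroup H'] [InnerProductSpace ℂ H'] {T : H →L[ℂ] H} {T' : H' →L[ℂ] H'}
    (h : Similar T T') : QuasiSimilar T T' := by
  obtain ⟨X, hX⟩ := h
  refine ⟨X, X.symm, ⟨X.injective, X.surjective.denseRange⟩,
    ⟨X.symm.injective, X.symm.surjective.denseRange⟩, hX, ?_⟩
  ext f
  have := DFunLike.congr_fun hX (X.symm f)
  simp only [ContinuousLinearMap.comp_apply, ContinuousLinearEquiv.coe_coe,
    ContinuousLinearEquiv.apply_symm_apply] at this ⊢
  rw [← this, ContinuousLinearEquiv.symm_apply_apply]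

/-- A space with the matrix kernel is described by triples of power series. -/
theorem nonempty_model {a : Fin 3 → ℕ → ℝ} {φ : ℂ → ℂ} (ha : ∀ i, IsDiagCoeff (a i))
    {H₁ : Type*} [NormedAddCommGroup H₁] [InnerProductSpace ℂ H₁] [CompleteSpace H₁]
    [RKHS ℂ H₁ UnitDisc ℂ] (hH₁ : RKHS.kernel H₁ = scalarKernel (diagKernel (a 0)))
    (hφ : φ ∈ Mult H₁) : ∃ m : PowerSeries ℂ,
    ∀ (H : Type*) [NormedAddCommGroup H] [InnerProductSpace ℂ H] [CompleteSpace H]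
      [RKHS ℂ H UnitDisc (EuclideanSpace ℂ (Fin 3))], RKHS.kernel H = matKernel a φ →
      Nonempty (Model a (starFun φ) m H) := by
  obtain ⟨m, hm, hE, hmul⟩ := exists_series_of_mem_mult (ha 0) H₁ hH₁ hφ
  refine ⟨m, fun H _ _ _ _ hH => ?_⟩
  obtain ⟨U, hU⟩ := exists_model ha hφ.1 H hH
  exact ⟨⟨ha, hm, hE, hmul, U, hU⟩⟩

end QS

end

theorem mainTheorem10
    (a a' : Fin 3 → ℕ → ℝ) (φ φ' : ℂ → ℂ)
    (ha : ∀ i, QS.IsDiagCoeff (a i)) (ha' : ∀ i, QS.IsDiagCoeff (a' i))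
    (H₁ : Type*) [NormedAddCommGroup H₁] [InnerProductSpace ℂ H₁] [CompleteSpace H₁]
    [RKHS ℂ H₁ Complex.UnitDisc ℂ]
    (hH₁ : RKHS.kernel H₁ = QS.scalarKernel (QS.diagKernel (a 0)))
    (hφ : φ ∈ QS.Mult H₁)
    (H₁' : Type*) [NormedAddCommGroup H₁'] [InnerProductSpace ℂ H₁'] [CompleteSpace H₁']
    [RKHS ℂ H₁' Complex.UnitDisc ℂ]
    (hH₁' : RKHS.kernel H₁' = QS.scalarKernel (QS.diagKernel (a' 0)))
    (hφ' : φ' ∈ QS.Mult H₁') :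
    (QS.matKernel a φ).PosSemidef ∧ (QS.matKernel a' φ').PosSemidef ∧
    ∀ (H : Type*) [NormedAddCommGroup H] [InnerProductSpace ℂ H] [CompleteSpace H]
      [RKHS ℂ H Complex.UnitDisc (EuclideanSpace ℂ (Fin 3))]
      (H' : Type*) [NormedAddCommGroup H'] [InnerProductSpace ℂ H'] [CompleteSpace H']
      [RKHS ℂ H' Complex.UnitDisc (EuclideanSpace ℂ (Fin 3))]
      (M : H →L[ℂ] H) (M' : H' →L[ℂ] H'),
      RKHS.kernel H = QS.matKernel a φ → RKHS.kernel H' = QS.matKernel a' φ' →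
      QS.IsMulZ M → QS.IsMulZ M' →
      (QS.QuasiSimilar (ContinuousLinearMap.adjoint M) (ContinuousLinearMap.adjoint M') ↔
        QS.Similar (ContinuousLinearMap.adjoint M) (ContinuousLinearMap.adjoint M')) := by
  refine ⟨QS.posSemidef_matKernel ha hφ.1, QS.posSemidef_matKernel ha' hφ'.1, ?_⟩
  intro H _ _ _ _ H' _ _ _ _ M M' hH hH' hM hM'
  obtain ⟨m, hm⟩ := QS.nonempty_model ha hH₁ hφ
  obtain ⟨m', hm'⟩ := QS.nonempty_model ha' hH₁' hφ'
  obtain ⟨μ⟩ := hm H hH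
  obtain ⟨μ'⟩ := hm' H' hH'
  exact ⟨μ.similar_of_quasiSimilar μ' hM hM', QS.Similar.quasiSimilar⟩
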